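/- Let $q\in(0,1)$ and $\alpha>0$. Let $\mathcal S=\{(s_x)_{x\in\mathbb Z}\in\mathbb Z^{\mathbb Z}: |s_{x+1}-s_x|=1 \text{ for all } x\}$, with the topology and $\sigma$-algebra inherited from the product of discrete spaces. The dynamic ASEP is the continuous-time Markov process $\vec s(t)$ on $\mathcal S$ in which, independently for each $x\in\mathbb Z$, $$s_x\mapsto s_x-2 \text{ at rate } \frac{q(1+\alpha q^{-s_x})}{1+\alpha q^{-s_x+1}},\qquad s_x\mapsto s_x+2\text{ at rate }\frac{1+\alpha q^{-s_x}}{1+\alpha q^{-s_x-1}},$$ jumps leaving $\mathcal S$ being suppressed; that is, it is an adapted process with right-continuous paths with left limits which solves the martingale problem for the corresponding generator on bounded functions of finitely many heights. A probability measure $\mu$ on $\mathcal S$ is called the law of stationary initial data if under $\mu$, for every $x\in\mathbb Z$, conditionally on $(s_y)_{y\ge x}$, $$s_{x-1}=s_x+1\text{ with probability }\frac{q^{s_x}}{\alpha+q^{s_x}},\qquad s_{x-1}=s_x-1\text{ with probability }\frac{\alpha}{\alpha+q^{s_x}},$$ and if $s_0$ is even almost surely with, for all $n\in\mathbb Z$,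 $$\mu(s_0=2n)=m_n:=\frac{\alpha^{-2n}q^{n(2n-1)}(1+\alpha^{-1}q^{2n})}{(-\alpha^{-1};q)_\infty(-q\alpha;q)_\infty(q;q)_\infty},\qquad (a;q)_\infty=\prod_{k\ge0}(1-aq^k).$$ **Theorem 2.4.** Such a law $\mu$ exists, and it is invariant for the dynamic ASEP: if $\vec s(t)$ is a dynamic ASEP and $\vec s(0)$ has law $\mu$, then $\vec s(t)$ has law $\mu$ for every $t\ge0$. -/

import Mathlib

open MeasureTheory ProbabilityTheory Filter Topology
open scoped NNReal ENNReal

noncomputable section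

namespace DynamicASEP

/-- Height functions: integer valued, with slopes `±1`. Topology and σ-algebra are inherited from
the product `ℤ → ℤ` of discrete spaces. -/
abbrev HeightFunction : Type := {s : ℤ → ℤ // ∀ x, |s (x + 1) - s x| = 1}

open scoped Classical in
/-- The configuration after the attempted jump `s_x ↦ s_x + c`; the jump is suppressed when it
would leave the state space. -/
def jump (x c : ℤ) (s : HeightFunction) : HeightFunction :=
  if h : ∀ y, |Function.update s.1 x (s.1 x + c) (y + 1) - Function.update s.1 x (s.1 x + c) y| = 1
  then ⟨Function.update s.1 x (s.1 x + c), h⟩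
  else s

/-- Rate of the jump `k ↦ k - 2` of the height at a site. -/
def rateDown (q α : ℝ) (k : ℤ) : ℝ :=
  q * (1 + α * q ^ (-k)) / (1 + α * q ^ (-k + 1))

/-- Rate of the jump `k ↦ k + 2` of the height at a site. -/
def rateUp (q α : ℝ) (k : ℤ) : ℝ :=
  (1 + α * q ^ (-k)) / (1 + α * q ^ (-k - 1))

/-- A function on height functions is local if it depends on finitely many heights. -/
def IsLocal (f : HeightFunction → ℝ) : Prop :=
  ∃ A : Finset ℤ, ∀ s t : HeightFunction, (∀ x ∈ A, s.1 x = t.1 x) → f s = f t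

/-- The generator of the dynamic ASEP; on a local function the sum has finite support. -/
def generator (q α : ℝ) (f : HeightFunction → ℝ) (s : HeightFunction) : ℝ :=
  ∑' x : ℤ, (rateDown q α (s.1 x) * (f (jump x (-2) s) - f s)
    + rateUp q α (s.1 x) * (f (jump x 2 s) - f s))

/-- `X` is a dynamic ASEP with respect to the filtration `ℱ` on the probability space `(Ω, P)`:
an adapted càdlàg process solving the martingale problem for the generator on bounded local
functions. -/
structure IsDynamicASEP (q α : ℝ) {Ω : Type*} {mΩ : MeasurableSpace Ω} (P : Measure Ω)
    (ℱ : Filtration ℝ≥0 mΩ) (X : ℝ≥0 → Ω → HeightFunction) : Prop where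
  adapted : ∀ t, Measurable[ℱ t] (X t)
  rightContinuous : ∀ ω t, ContinuousWithinAt (fun r => X r ω) (Set.Ici t) t
  leftLimits : ∀ ω t, ∃ l : HeightFunction, Tendsto (fun r => X r ω) (𝓝[<] t) (𝓝 l)
  martingale : ∀ f : HeightFunction → ℝ, IsLocal f → (∃ C, ∀ s, |f s| ≤ C) →
    Martingale (fun (t : ℝ≥0) ω => f (X t ω) - f (X 0 ω)
      - ∫ r in (0 : ℝ)..(t : ℝ), generator q α f (X r.toNNReal ω)) ℱ P

/-- The infinite `q`-Pochhammer symbol `(a; q)_∞`. -/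
def qPochhammerInf (a q : ℝ) : ℝ := ∏' k : ℕ, (1 - a * q ^ k)

/-- The one-point weights `m_n`. -/
def weight (q α : ℝ) (n : ℤ) : ℝ :=
  α ^ (-2 * n) * q ^ (n * (2 * n - 1)) * (1 + α⁻¹ * q ^ (2 * n)) /
    (qPochhammerInf (-α⁻¹) q * qPochhammerInf (-q * α) q * qPochhammerInf q q)

/-- The σ-algebra generated by the heights `s_y`, `y ≥ x`. -/
abbrev heightsFrom (x : ℤ) : MeasurableSpace HeightFunction :=
  ⨆ y ∈ Set.Ici x, MeasurableSpace.comap (fun s : HeightFunction => s.1 y) inferInstance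

/-- `μ` is the law of stationary initial data: along decreasing `x`, the heights form a Markov
chain with the half-stationary transition probabilities, and `s_0` takes the value `2n` with
probability `m_n`. -/
structure IsStationaryInitialData (q α : ℝ) (μ : Measure HeightFunction) : Prop where
  isProbabilityMeasure : IsProbabilityMeasure μ
  step_up : ∀ x : ℤ, μ⟦{s : HeightFunction | s.1 (x - 1) = s.1 x + 1} | heightsFrom x⟧
    =ᵐ[μ] fun s => q ^ s.1 x / (α + q ^ s.1 x)
  step_down : ∀ x : ℤ, μ⟦{s : HeightFunction | s.1 (x - 1) = s.1 x - 1} | heightsFrom x⟧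
    =ᵐ[μ] fun s => α / (α + q ^ s.1 x)
  marginal : μ.map (fun s : HeightFunction => s.1 0)
    = Measure.sum fun n : ℤ => ENNReal.ofReal (weight q α n) • Measure.dirac (2 * n)

end DynamicASEP

end

/-! Read from right to left, stationary data is a Markov chain with nearest-neighbour kernel
`trans`, and the jump rates are tuned to it. If both neighbours of a site have height `k`, then the
chain weight of a peak at `k + 1` times its downward rate, and that of a valley at `k - 1` times its
upward rate, both equal `α q^k / (α + q^k)^2` (`rate_balance`). A jump at `x` changes only the two
chain factors next to `x`, so detailed balance holds at each site separately, and the generator `L`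
satisfies `∫ L f dμ = 0` for bounded local `f` (`IsStationaryInitialData.integral_generator`).

This passes to positive times because the rates are bounded and the interaction has range one. If
`f` lives on `[-n, n]` with `|f| ≤ C`, then `L f` lives on `[-n-1, n+1]` with `|L f| ≤ 8 (n + 1) C`.
The defect `D f t = E f(X_t) - ∫ f dμ` satisfies `D f t = ∫_0^t D (L f) r dr`. Iterating `k` times
bounds it by `2 C (8 t)^k binom(n + k, k)`, which tends to `0` for `t ≤ 1/32` (`forward_bound`,
`forward_eq_zero`). Restarting at multiples of `1/32` reaches every time.

For existence, the Jacobi triple product (`tsum_thetaTerm`) normalizes the theta terms to edge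
weights `e_k` with `m_n = e_{2n} + e_{2n+1}`, so the `m_n` sum to `1`. The weights `e_k + e_{k+1}`,
restricted to the parity of the site, are reversible for `trans` (`siteWeight_reversible`). Hence
two walks with kernel `trans`, run from the origin to the left and to the right, form a height
function that is the required chain when read leftwards from any site. -/

namespace DynamicASEP

/-! ### Cylinders determine finite measures -/

/-- The cylinder of height functions that agree with `h` on `F`. -/
def cyl (F : Finset ℤ) (h : ℤ → ℤ) : Set HeightFunction := {s | ∀ y ∈ F, s.1 y = h y}

/-- All cylinders over the members of a sequence of finite sets. -/
def cylinders (F : ℕ → Finset ℤ) : Set (Set HeightFunction) := {S | ∃ n h, S = cyl (F n) h}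

lemma mem_cyl {F : Finset ℤ} {h : ℤ → ℤ} {s : HeightFunction} :
    s ∈ cyl F h ↔ ∀ y ∈ F, s.1 y = h y := Iff.rfl

lemma cyl_congr {F : Finset ℤ} {h h' : ℤ → ℤ} (H : ∀ y ∈ F, h y = h' y) : cyl F h = cyl F h' := by
  ext s
  exact forall₂_congr fun y hy => by rw [H y hy]

lemma measurable_height (y : ℤ) : Measurable fun s : HeightFunction => s.1 y :=
  (measurable_pi_apply y).comp measurable_subtype_coe

lemma measurableSet_cyl (F : Finset ℤ) (h : ℤ → ℤ) : MeasurableSet (cyl F h) := by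
  have : cyl F h = ⋂ y ∈ F, (fun s : HeightFunction => s.1 y) ⁻¹' {h y} := by
    ext s; simp [mem_cyl]
  rw [this]
  exact Finset.measurableSet_biInter _ fun y _ => measurable_height y (measurableSet_singleton _)

/-- If two cylinders share a point `s`, their intersection is the cylinder of `s` over the larger of
the two nested sets. -/
lemma isPiSystem_cylinders {F : ℕ → Finset ℤ} (hF : Monotone F) : IsPiSystem (cylinders F) := by
  rintro _ ⟨n, h, rfl⟩ _ ⟨m, h', rfl⟩ ⟨s, hs, hs'⟩
  refine ⟨max n m, s.1, ?_⟩
  ext t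
  constructor
  · rintro ⟨ht, ht'⟩ y hy
    rcases le_total n m with hnm | hnm
    · rw [max_eq_right hnm] at hy
      rw [ht' y hy, hs' y hy]
    · rw [max_eq_left hnm] at hy
      rw [ht y hy, hs y hy]
  · intro ht
    exact ⟨fun y hy => by rw [ht y (hF (le_max_left n m) hy), hs y hy],
      fun y hy => by rw [ht y (hF (le_max_right n m) hy), hs' y hy]⟩

/-- Extension by zero of a configuration on a finite set. -/
def extendZero {F : Finset ℤ} (g : F → ℤ) (y : ℤ) : ℤ := if hy : y ∈ F then g ⟨y, hy⟩ else 0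

lemma mem_cyl_extendZero (F : Finset ℤ) (s : HeightFunction) :
    s ∈ cyl F (extendZero fun y : F => s.1 y) := by
  intro y hy
  simp [extendZero, hy]

lemma generateFrom_cylinders (F : ℕ → Finset ℤ) :
    MeasurableSpace.generateFrom (cylinders F) =
      ⨆ y ∈ ⋃ n, (F n : Set ℤ),
        MeasurableSpace.comap (fun s : HeightFunction => s.1 y) inferInstance := by
  apply le_antisymm
  · refine MeasurableSpace.generateFrom_le ?_
    rintro _ ⟨n, h, rfl⟩
    have : cyl (F n) h = ⋂ y ∈ F n, (fun s : HeightFunction => s.1 y) ⁻¹' {h y} := by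
      ext s; simp [mem_cyl]
    rw [this]
    refine Finset.measurableSet_biInter _ fun y hy => ?_
    refine le_iSup₂ (f := fun (y : ℤ) (_ : y ∈ ⋃ n, (F n : Set ℤ)) =>
      MeasurableSpace.comap (fun s : HeightFunction => s.1 y) inferInstance) y
      (Set.mem_iUnion.2 ⟨n, hy⟩) _ ?_
    exact ⟨{h y}, measurableSet_singleton _, rfl⟩
  · refine iSup₂_le fun y hy => ?_
    obtain ⟨n, hn⟩ := Set.mem_iUnion.1 hy
    rintro _ ⟨B, -, rfl⟩
    have : (fun s : HeightFunction => s.1 y) ⁻¹' B =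
        ⋃ g ∈ {g : F n → ℤ | g ⟨y, hn⟩ ∈ B}, cyl (F n) (extendZero g) := by
      ext s
      simp only [Set.mem_preimage, Set.mem_iUnion, Set.mem_ofPred_eq, exists_prop]
      constructor
      · intro hs
        exact ⟨fun y => s.1 y, hs, mem_cyl_extendZero _ s⟩
      · rintro ⟨g, hg, hs⟩
        have hn' : y ∈ F n := hn
        rw [hs y hn]
        simpa [extendZero, hn'] using hg
    rw [this]
    exact MeasurableSet.biUnion (Set.to_countable _) fun g _ =>
      MeasurableSpace.measurableSet_generateFrom ⟨n, _, rfl⟩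

lemma heightFunction_measurableSpace_eq :
    (inferInstance : MeasurableSpace HeightFunction) =
      ⨆ y : ℤ, MeasurableSpace.comap (fun s : HeightFunction => s.1 y) inferInstance := by
  change MeasurableSpace.comap _ (⨆ y : ℤ, _) = _
  rw [MeasurableSpace.comap_iSup]
  simp only [MeasurableSpace.comap_comp]
  rfl

lemma generateFrom_cylinders_eq_top {F : ℕ → Finset ℤ} (hF : ∀ y, ∃ n, y ∈ F n) :
    (inferInstance : MeasurableSpace HeightFunction) =
      MeasurableSpace.generateFrom (cylinders F) := by
  rw [generateFrom_cylinders, heightFunction_measurableSpace_eq]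
  have : (⋃ n, (F n : Set ℤ)) = Set.univ := by
    ext y; simpa using hF y
  simp [this]

lemma heightsFrom_eq_generateFrom (x : ℤ) :
    heightsFrom x = MeasurableSpace.generateFrom
      (cylinders fun n : ℕ => Finset.Icc x (x + n)) := by
  rw [generateFrom_cylinders]
  have : (⋃ n : ℕ, ((Finset.Icc x (x + n) : Finset ℤ) : Set ℤ)) = Set.Ici x := by
    ext y
    simp only [Finset.coe_Icc, Set.mem_iUnion, Set.mem_Icc, Set.mem_Ici]
    exact ⟨fun ⟨n, h, _⟩ => h, fun h => ⟨(y - x).toNat, h, by omega⟩⟩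
  rw [this]

lemma heightsFrom_le (x : ℤ) : heightsFrom x ≤ (inferInstance : MeasurableSpace HeightFunction) := by
  rw [heightFunction_measurableSpace_eq]
  exact iSup₂_le_iSup _ _

/-- Measures that are finite and equal on cylinders are equal. -/
lemma ext_of_generateFrom_cylinders {m : MeasurableSpace HeightFunction} {μ ν : Measure[m] _}
    [IsFiniteMeasure μ] {F : ℕ → Finset ℤ} (hm : m = MeasurableSpace.generateFrom (cylinders F))
    (hmono : Monotone F) (H : ∀ n h, μ (cyl (F n) h) = ν (cyl (F n) h)) : μ = ν := by
  -- The whole space need not be a cylinder, but the countably many cylinders over `F 0` cover it.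
  refine Measure.ext_of_generateFrom_of_cover_subset
    (T := Set.range fun g : F 0 → ℤ => cyl (F 0) (extendZero g))
    hm (isPiSystem_cylinders hmono) ?_ (Set.countable_range _) ?_
    (fun _ _ => measure_ne_top _ _) ?_
  · rintro _ ⟨g, rfl⟩
    exact ⟨0, _, rfl⟩
  · refine Set.eq_univ_of_forall fun s => ?_
    exact ⟨_, ⟨fun y => s.1 y, rfl⟩, mem_cyl_extendZero _ s⟩
  · rintro _ ⟨n, h, rfl⟩
    exact H n h

lemma ext_of_cyl {μ ν : Measure HeightFunction} [IsFiniteMeasure μ] {F : ℕ → Finset ℤ}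
    (hmono : Monotone F) (hF : ∀ y, ∃ n, y ∈ F n)
    (H : ∀ n h, μ (cyl (F n) h) = ν (cyl (F n) h)) : μ = ν :=
  ext_of_generateFrom_cylinders (generateFrom_cylinders_eq_top hF) hmono H

/-! ### Peaks, valleys and jumps -/

/-- The site `x` is a local maximum. -/
def peak (x : ℤ) : Set HeightFunction := {s | s.1 (x - 1) = s.1 x - 1 ∧ s.1 (x + 1) = s.1 x - 1}

/-- The site `x` is a local minimum. -/
def valley (x : ℤ) : Set HeightFunction := {s | s.1 (x - 1) = s.1 x + 1 ∧ s.1 (x + 1) = s.1 x + 1}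

lemma step_cases (s : HeightFunction) (x : ℤ) :
    (s.1 (x - 1) = s.1 x + 1 ∨ s.1 (x - 1) = s.1 x - 1) ∧
      (s.1 (x + 1) = s.1 x + 1 ∨ s.1 (x + 1) = s.1 x - 1) := by
  have h1 := s.2 (x - 1)
  have h2 := s.2 x
  rw [sub_add_cancel] at h1
  rcases abs_cases (s.1 x - s.1 (x - 1)) with h | h <;>
  rcases abs_cases (s.1 (x + 1) - s.1 x) with h' | h' <;> omega

lemma update_valid_iff (s : HeightFunction) (x c : ℤ) :
    (∀ y, |Function.update s.1 x (s.1 x + c) (y + 1) - Function.update s.1 x (s.1 x + c) y| = 1) ↔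
      |s.1 x + c - s.1 (x - 1)| = 1 ∧ |s.1 (x + 1) - (s.1 x + c)| = 1 := by
  constructor
  · intro H
    have h1 := H (x - 1)
    have h2 := H x
    simp only [sub_add_cancel, Function.update_self] at h1 h2
    rw [Function.update_of_ne (by omega)] at h1 h2
    exact ⟨h1, h2⟩
  · rintro ⟨h1, h2⟩ y
    by_cases hy : y = x
    · subst hy
      rw [Function.update_self, Function.update_of_ne (by omega)]
      exact h2
    · by_cases hy' : y + 1 = x
      · subst hy'
        rw [Function.update_self, Function.update_of_ne hy]
        simpa using h1
      · rw [Function.update_of_ne hy, Function.update_of_ne hy']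
        exact s.2 y

lemma jump_val_of_ne (x c : ℤ) (s : HeightFunction) {y : ℤ} (hy : y ≠ x) :
    (jump x c s).1 y = s.1 y := by
  unfold jump
  split_ifs with h
  · exact Function.update_of_ne hy _ _
  · rfl

lemma jump_val_self (x c : ℤ) (s : HeightFunction) :
    (jump x c s).1 x = if |s.1 x + c - s.1 (x - 1)| = 1 ∧ |s.1 (x + 1) - (s.1 x + c)| = 1
      then s.1 x + c else s.1 x := by
  unfold jump
  simp only [update_valid_iff]
  split_ifs with h
  · exact Function.update_self _ _ _
  · rfl

lemma jump_down_val (x : ℤ) {s : HeightFunction} (hs : s ∈ peak x) :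
    (jump x (-2) s).1 x = s.1 x - 2 := by
  obtain ⟨h1, h2⟩ := hs
  rw [jump_val_self, h1, h2]
  ring_nf
  simp

lemma jump_up_val (x : ℤ) {s : HeightFunction} (hs : s ∈ valley x) :
    (jump x 2 s).1 x = s.1 x + 2 := by
  obtain ⟨h1, h2⟩ := hs
  rw [jump_val_self, h1, h2]
  ring_nf
  simp

lemma jump_eq_self_of {x c : ℤ} {s : HeightFunction} (h : (jump x c s).1 x = s.1 x) :
    jump x c s = s := by
  apply Subtype.ext
  funext y
  by_cases hy : y = x
  · rw [hy, h]
  · exact jump_val_of_ne x c s hy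

lemma jump_down_of_not_peak {x : ℤ} {s : HeightFunction} (hs : s ∉ peak x) :
    jump x (-2) s = s := by
  apply jump_eq_self_of
  rw [jump_val_self, if_neg]
  rintro ⟨h1, h2⟩
  apply hs
  have := step_cases s x
  rcases abs_cases (s.1 x + -2 - s.1 (x - 1)) with h | h <;>
  rcases abs_cases (s.1 (x + 1) - (s.1 x + -2)) with h' | h' <;> constructor <;> omega

lemma jump_up_of_not_valley {x : ℤ} {s : HeightFunction} (hs : s ∉ valley x) :
    jump x 2 s = s := by
  apply jump_eq_self_of
  rw [jump_val_self, if_neg]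
  rintro ⟨h1, h2⟩
  apply hs
  have := step_cases s x
  rcases abs_cases (s.1 x + 2 - s.1 (x - 1)) with h | h <;>
  rcases abs_cases (s.1 (x + 1) - (s.1 x + 2)) with h' | h' <;> constructor <;> omega

lemma jump_up_jump_down {x : ℤ} {s : HeightFunction} (hs : s ∈ peak x) :
    jump x 2 (jump x (-2) s) = s := by
  have hv : jump x (-2) s ∈ valley x := by
    have h1 := hs.1
    have h2 := hs.2
    constructor <;> rw [jump_down_val x hs, jump_val_of_ne _ _ _ (by omega)] <;> omega
  apply Subtype.ext
  funext y
  by_cases hy : y = x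
  · rw [hy, jump_up_val x hv, jump_down_val x hs]; ring
  · rw [jump_val_of_ne _ _ _ hy, jump_val_of_ne _ _ _ hy]

lemma measurableSet_peak (x : ℤ) : MeasurableSet (peak x) :=
  (measurableSet_eq_fun (measurable_height _) ((measurable_height _).sub_const 1)).inter
    (measurableSet_eq_fun (measurable_height _) ((measurable_height _).sub_const 1))

lemma measurableSet_valley (x : ℤ) : MeasurableSet (valley x) :=
  (measurableSet_eq_fun (measurable_height _) ((measurable_height _).add_const 1)).inter
    (measurableSet_eq_fun (measurable_height _) ((measurable_height _).add_const 1))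

lemma measurable_of_heights {Ω : Type*} [MeasurableSpace Ω] {g : Ω → HeightFunction}
    (hg : ∀ y, Measurable fun s => (g s).1 y) : Measurable g :=
  Measurable.subtype_mk (h := fun s => (g s).2) (measurable_pi_iff.2 hg)

lemma measurable_jump (x c : ℤ) : Measurable (jump x c) := by
  refine measurable_of_heights fun y => ?_
  by_cases hy : y = x
  · subst hy
    simp only [jump_val_self]
    refine Measurable.ite ?_ ((measurable_height _).add_const c) (measurable_height _)
    have : Measurable fun k : ℤ => |k| := measurable_from_top
    exact (measurableSet_eq_fun (this.comp (((measurable_height _).add_const c).sub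
      (measurable_height _))) measurable_const).inter (measurableSet_eq_fun (this.comp
        ((measurable_height _).sub ((measurable_height _).add_const c))) measurable_const)
  · simp only [jump_val_of_ne _ _ _ hy]
    exact measurable_height y

end DynamicASEP

/-! ### Transition probabilities and detailed balance -/

namespace DynamicASEP

/-- Transition probability of the half-stationary Markov chain. -/
noncomputable def trans (q α : ℝ) (k l : ℤ) : ℝ :=
  if l = k + 1 then q ^ k / (α + q ^ k) else if l = k - 1 then α / (α + q ^ k) else 0

lemma trans_up (q α : ℝ) (k : ℤ) : trans q α k (k + 1) = q ^ k / (α + q ^ k) := by simp [trans]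

lemma trans_down (q α : ℝ) (k : ℤ) : trans q α k (k - 1) = α / (α + q ^ k) := by
  rw [trans, if_neg (by omega), if_pos rfl]

variable {q α : ℝ}

lemma measurableSet_cyl_heightsFrom {x b : ℤ} (hb : x ≤ b) (h : ℤ → ℤ) :
    MeasurableSet[heightsFrom x] (cyl (Finset.Icc x b) h) := by
  rw [heightsFrom_eq_generateFrom]
  refine MeasurableSpace.measurableSet_generateFrom ⟨(b - x).toNat, h, ?_⟩
  dsimp only
  rw [show x + ((b - x).toNat : ℤ) = b by omega]

lemma cyl_Icc_pred {x b : ℤ} (hb : x ≤ b) (h : ℤ → ℤ) :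
    cyl (Finset.Icc (x - 1) b) h = cyl (Finset.Icc x b) h ∩ {s | s.1 (x - 1) = h (x - 1)} := by
  ext s
  simp only [mem_cyl, Set.mem_inter_iff, Set.mem_ofPred_eq, Finset.mem_Icc]
  constructor
  · exact fun H => ⟨fun y hy => H y ⟨by omega, hy.2⟩, H _ ⟨le_rfl, by omega⟩⟩
  · rintro ⟨H, H'⟩ y ⟨hy, hy'⟩
    rcases hy.lt_or_eq with h1 | h1
    · exact H y ⟨by omega, hy'⟩
    · rw [← h1, H']

/-- The cylinder is measurable for the heights from `x` on, and the conditional probability is the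
constant `p (h x)` on it; integrate. -/
lemma measureReal_cyl_inter {μ : Measure HeightFunction} [IsProbabilityMeasure μ] {x b : ℤ}
    (hb : x ≤ b) (h : ℤ → ℤ) {E : Set HeightFunction} (hE : MeasurableSet E) {p : ℤ → ℝ}
    (H : μ⟦E | heightsFrom x⟧ =ᵐ[μ] fun s => p (s.1 x)) :
    μ.real (cyl (Finset.Icc x b) h ∩ E) = p (h x) * μ.real (cyl (Finset.Icc x b) h) := by
  have hm := heightsFrom_le x
  have hC := measurableSet_cyl_heightsFrom hb h
  have hC' := hm _ hC
  have h1 := setIntegral_condExp (μ := μ) hm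
    (f := E.indicator fun _ => (1 : ℝ)) ((integrable_const _).indicator hE) hC
  rw [setIntegral_congr_ae (g := fun _ => p (h x)) hC'] at h1
  · rw [setIntegral_const, smul_eq_mul, setIntegral_indicator hE, setIntegral_const, smul_eq_mul,
      mul_one] at h1
    rw [← h1, mul_comm]
  · filter_upwards [H] with s hs hsC
    rw [hs, hsC x (Finset.mem_Icc.2 ⟨le_rfl, hb⟩)]

/-- The Markov property on finite windows. This is the form in which stationarity enters detailed
balance. -/
lemma IsStationaryInitialData.measureReal_cyl_pred {μ : Measure HeightFunction}
    (hμ : IsStationaryInitialData q α μ) {x b : ℤ} (hb : x ≤ b) (h : ℤ → ℤ) :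
    μ.real (cyl (Finset.Icc (x - 1) b) h) =
      trans q α (h x) (h (x - 1)) * μ.real (cyl (Finset.Icc x b) h) := by
  have := hμ.isProbabilityMeasure
  rw [cyl_Icc_pred hb]
  by_cases h1 : h (x - 1) = h x + 1
  · have hE : MeasurableSet {s : HeightFunction | s.1 (x - 1) = s.1 x + 1} :=
      measurableSet_eq_fun (measurable_height _) ((measurable_height _).add_const 1)
    rw [h1, trans_up, ← measureReal_cyl_inter (p := fun k => q ^ k / (α + q ^ k)) hb h hE
      (hμ.step_up x)]
    congr 1
    ext s
    refine and_congr_right fun hs => ?_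
    simp [hs x (Finset.mem_Icc.2 ⟨le_rfl, hb⟩)]
  · by_cases h2 : h (x - 1) = h x - 1
    · have hE : MeasurableSet {s : HeightFunction | s.1 (x - 1) = s.1 x - 1} :=
        measurableSet_eq_fun (measurable_height _) ((measurable_height _).sub_const 1)
      rw [h2, trans_down, ← measureReal_cyl_inter (p := fun k => α / (α + q ^ k)) hb h hE
        (hμ.step_down x)]
      congr 1
      ext s
      refine and_congr_right fun hs => ?_
      simp [hs x (Finset.mem_Icc.2 ⟨le_rfl, hb⟩)]
    · rw [trans, if_neg h1, if_neg h2, zero_mul]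
      convert measureReal_empty
      ext s
      simp only [Set.mem_inter_iff, Set.mem_ofPred_eq, Set.mem_empty_iff_false, iff_false, not_and]
      intro hs hs'
      have := hs x (Finset.mem_Icc.2 ⟨le_rfl, hb⟩)
      have := step_cases s x
      omega

/-- Both sides equal `α q^k / (α + q^k)^2`: each rate cancels the one denominator that differs
between peak and valley. -/
lemma rate_balance (hq : 0 < q) (hα : 0 < α) (k : ℤ) :
    trans q α k (k + 1) * trans q α (k + 1) k * rateDown q α (k + 1) =
      trans q α k (k - 1) * trans q α (k - 1) k * rateUp q α (k - 1) := by
  have h1 := trans_down q α (k + 1)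
  have h2 := trans_up q α (k - 1)
  rw [add_sub_cancel_right] at h1
  rw [sub_add_cancel] at h2
  rw [h1, h2, trans_up, trans_down, rateDown, rateUp]
  have e1 : q ^ (k + 1) = q ^ k * q := zpow_add_one₀ hq.ne' k
  have e2 : q ^ (k - 1) = q ^ k / q := by rw [zpow_sub_one₀ hq.ne', div_eq_mul_inv]
  have e3 : q ^ (-(k + 1)) = (q ^ k * q)⁻¹ := by rw [zpow_neg, e1]
  have e4 : q ^ (-(k + 1) + 1) = (q ^ k)⁻¹ := by rw [← zpow_neg]; congr 1; ring
  have e5 : q ^ (-(k - 1)) = q / q ^ k := by rw [zpow_neg, e2, inv_div]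
  have e6 : q ^ (-(k - 1) - 1) = (q ^ k)⁻¹ := by rw [← zpow_neg]; congr 1; ring
  rw [e1, e2, e3, e4, e5, e6]
  have hk : 0 < q ^ k := zpow_pos hq k
  generalize q ^ k = Q at hk
  have p1 : α + Q ≠ 0 := by positivity
  have p2 : α + Q * q ≠ 0 := by positivity
  have p3 : α * q + Q ≠ 0 := by positivity
  have p4 : 1 + α * Q⁻¹ ≠ 0 := by positivity
  field_simp
  ring

lemma rateDown_nonneg (hq : 0 < q) (hα : 0 < α) (k : ℤ) : 0 ≤ rateDown q α k := by
  unfold rateDown; positivity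

lemma rateUp_nonneg (hq : 0 < q) (hα : 0 < α) (k : ℤ) : 0 ≤ rateUp q α k := by
  unfold rateUp; positivity

lemma rateDown_le_one (hq : 0 < q) (hq1 : q < 1) (hα : 0 < α) (k : ℤ) : rateDown q α k ≤ 1 := by
  unfold rateDown
  rw [div_le_one (by positivity), zpow_add_one₀ hq.ne']
  have : 0 < q ^ (-k) := zpow_pos hq _
  nlinarith

lemma rateUp_le_one (hq : 0 < q) (hq1 : q < 1) (hα : 0 < α) (k : ℤ) : rateUp q α k ≤ 1 := by
  unfold rateUp
  rw [div_le_one (by positivity)]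
  gcongr 1 + α * ?_
  exact zpow_le_zpow_right_of_le_one₀ hq hq1.le (by omega)

/-- The two configurations differ only at `x`. The heights from `x + 1` on contribute a common
factor, the two steps around `x` are balanced by `rate_balance` with `k = h x + 1`, and each further
site to the left multiplies both sides by the same transition probability. -/
lemma IsStationaryInitialData.detailed_balance {μ : Measure HeightFunction}
    (hμ : IsStationaryInitialData q α μ) (hq : 0 < q) (hα : 0 < α) {x b : ℤ} {h : ℤ → ℤ}
    (h1 : h (x - 1) = h x + 1) (h2 : h (x + 1) = h x + 1) (hb : x + 1 ≤ b) (n : ℕ) :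
    μ.real (cyl (Finset.Icc (x - 1 - n) b) (Function.update h x (h x + 2))) *
        rateDown q α (h x + 2) =
      μ.real (cyl (Finset.Icc (x - 1 - n) b) h) * rateUp q α (h x) := by
  induction n with
  | zero =>
    have e : ∀ h : ℤ → ℤ, μ.real (cyl (Finset.Icc (x - 1) b) h) = trans q α (h x) (h (x - 1)) *
        (trans q α (h (x + 1)) (h x) * μ.real (cyl (Finset.Icc (x + 1) b) h)) := by
      intro h
      rw [hμ.measureReal_cyl_pred (by omega)]
      have := hμ.measureReal_cyl_pred hb h
      rw [add_sub_cancel_right] at this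
      rw [this]
    have e2 : cyl (Finset.Icc (x + 1) b) (Function.update h x (h x + 2)) =
        cyl (Finset.Icc (x + 1) b) h := by
      refine cyl_congr fun y hy => Function.update_of_ne ?_ _ _
      rw [Finset.mem_Icc] at hy
      omega
    rw [Nat.cast_zero, sub_zero, e, e, e2, Function.update_self, Function.update_of_ne (by omega),
      Function.update_of_ne (by omega), h1, h2]
    have := rate_balance hq hα (h x + 1)
    rw [add_sub_cancel_right, show h x + 1 + 1 = h x + 2 by ring] at this
    linear_combination this * μ.real (cyl (Finset.Icc (x + 1) b) h)
  | succ n ih =>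
    rw [Nat.cast_succ, ← sub_sub, hμ.measureReal_cyl_pred (by omega),
      hμ.measureReal_cyl_pred (by omega)]
    rw [Function.update_of_ne (by omega), Function.update_of_ne (by omega)]
    linear_combination trans q α (h (x - 1 - n)) (h (x - 1 - n - 1)) * ih

/-! ### Balanced flows and infinitesimal invariance -/

/-- The rate of the transitions `s_x ↦ s_x - 2`. -/
noncomputable def flowDown (q α : ℝ) (x : ℤ) : HeightFunction → ℝ :=
  (peak x).indicator fun s => rateDown q α (s.1 x)

/-- The rate of the transitions `s_x ↦ s_x + 2`. -/
noncomputable def flowUp (q α : ℝ) (x : ℤ) : HeightFunction → ℝ :=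
  (valley x).indicator fun s => rateUp q α (s.1 x)

lemma measurable_comp_height (p : ℤ → ℝ) (x : ℤ) :
    Measurable fun s : HeightFunction => p (s.1 x) :=
  (measurable_from_top (f := p)).comp (measurable_height x)

lemma measurable_flowDown (x : ℤ) : Measurable (flowDown q α x) :=
  (measurable_comp_height _ x).indicator (measurableSet_peak x)

lemma measurable_flowUp (x : ℤ) : Measurable (flowUp q α x) :=
  (measurable_comp_height _ x).indicator (measurableSet_valley x)

lemma flowDown_nonneg (hq : 0 < q) (hα : 0 < α) (x : ℤ) (s : HeightFunction) :
    0 ≤ flowDown q α x s := Set.indicator_nonneg (fun _ _ => rateDown_nonneg hq hα _) s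

lemma flowUp_nonneg (hq : 0 < q) (hα : 0 < α) (x : ℤ) (s : HeightFunction) :
    0 ≤ flowUp q α x s := Set.indicator_nonneg (fun _ _ => rateUp_nonneg hq hα _) s

lemma flowDown_le_one (hq : 0 < q) (hq1 : q < 1) (hα : 0 < α) (x : ℤ) (s : HeightFunction) :
    flowDown q α x s ≤ 1 :=
  Set.indicator_le' (fun _ _ => rateDown_le_one hq hq1 hα _) (fun _ _ => zero_le_one) s

lemma flowUp_le_one (hq : 0 < q) (hq1 : q < 1) (hα : 0 < α) (x : ℤ) (s : HeightFunction) :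
    flowUp q α x s ≤ 1 :=
  Set.indicator_le' (fun _ _ => rateUp_le_one hq hq1 hα _) (fun _ _ => zero_le_one) s

lemma lintegral_flow_const {μ : Measure HeightFunction} [IsFiniteMeasure μ] {φ : HeightFunction → ℝ}
    {S T : Set HeightFunction} {c : ℝ} (hS : MeasurableSet S) (hT : MeasurableSet T)
    (hTS : T ⊆ S) (H0 : ∀ s ∈ S, s ∉ T → φ s = 0) (H1 : ∀ s ∈ T, φ s = c) :
    ∫⁻ s in S, ENNReal.ofReal (φ s) ∂μ = ENNReal.ofReal (μ.real T * c) := by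
  have : ∫⁻ s in S, ENNReal.ofReal (φ s) ∂μ =
      ∫⁻ s in S, T.indicator (fun _ => ENNReal.ofReal c) s ∂μ := by
    refine setLIntegral_congr_fun hS fun s hs => ?_
    by_cases hsT : s ∈ T
    · simp [hsT, H1 s hsT]
    · simp [hsT, H0 s hs hsT]
  rw [this, lintegral_indicator hT, lintegral_const, Measure.restrict_apply_univ,
    Measure.restrict_apply hT, Set.inter_eq_left.2 hTS, mul_comm,
    ENNReal.ofReal_mul measureReal_nonneg, ofReal_measureReal]

/-- Detailed balance as an identity of measures: the flow out of the peaks at `x`, carried along its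
jump, is the flow out of the valleys. -/
lemma IsStationaryInitialData.map_flowDown {μ : Measure HeightFunction}
    (hμ : IsStationaryInitialData q α μ) (hq : 0 < q) (hq1 : q < 1) (hα : 0 < α) (x : ℤ) :
    (μ.withDensity fun s => ENNReal.ofReal (flowDown q α x s)).map (jump x (-2)) =
      μ.withDensity fun s => ENNReal.ofReal (flowUp q α x s) := by
  have := hμ.isProbabilityMeasure
  have : IsFiniteMeasure (μ.withDensity fun s => ENNReal.ofReal (flowDown q α x s)) := by
    refine isFiniteMeasure_withDensity_ofReal ?_
    refine (Integrable.of_bound (C := 1) (measurable_flowDown x).aestronglyMeasurable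
      (ae_of_all _ fun s => ?_)).2
    rw [Real.norm_of_nonneg (flowDown_nonneg hq hα x s)]
    exact flowDown_le_one hq hq1 hα x s
  -- Every window contains `x - 1`, `x` and `x + 1`, so a cylinder decides whether `x` is a valley.
  -- If it is, the peaks that jump into it form the cylinder with height `h x + 2` at `x`; if not,
  -- both sides vanish.
  refine ext_of_cyl (F := fun n : ℕ => Finset.Icc (x - 1 - n) (x + 1 + n)) ?_ ?_ fun n h => ?_
  · intro n m hnm
    exact Finset.Icc_subset_Icc (by omega) (by omega)
  · intro y
    refine ⟨(y - x).natAbs, ?_⟩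
    rw [Finset.mem_Icc]
    omega
  · have hx : ∀ y, x - 1 ≤ y → y ≤ x + 1 → y ∈ Finset.Icc (x - 1 - n) (x + 1 + n : ℤ) :=
      fun y h1 h2 => Finset.mem_Icc.2 ⟨by omega, by omega⟩
    have hC := measurableSet_cyl (Finset.Icc (x - 1 - n) (x + 1 + n : ℤ)) h
    have hJ := measurable_jump x (-2) hC
    rw [Measure.map_apply (measurable_jump x (-2)) hC, withDensity_apply _ hJ,
      withDensity_apply _ hC]
    by_cases hv : h (x - 1) = h x + 1 ∧ h (x + 1) = h x + 1
    · obtain ⟨h1, h2⟩ := hv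
      have hpk : ∀ s ∈ cyl (Finset.Icc (x - 1 - n) (x + 1 + n))
          (Function.update h x (h x + 2)), s ∈ peak x ∧ s.1 x = h x + 2 := by
        intro s hs
        have a1 := hs (x - 1) (hx _ (by omega) (by omega))
        have a2 := hs (x + 1) (hx _ (by omega) (by omega))
        have a3 := hs x (hx _ (by omega) (by omega))
        rw [Function.update_of_ne (by omega)] at a1 a2
        rw [Function.update_self] at a3
        exact ⟨⟨by omega, by omega⟩, a3⟩
      rw [lintegral_flow_const (T := cyl (Finset.Icc (x - 1 - n) (x + 1 + n))
          (Function.update h x (h x + 2))) hJ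
          (measurableSet_cyl _ _),
        lintegral_flow_const (T := cyl (Finset.Icc (x - 1 - n) (x + 1 + n)) h) hC hC subset_rfl,
        hμ.detailed_balance hq hα h1 h2 (by omega)]
      · intro s hs hs'
        exact absurd hs hs'
      · intro s hs
        have a1 := hs (x - 1) (hx _ (by omega) (by omega))
        have a2 := hs (x + 1) (hx _ (by omega) (by omega))
        have a3 := hs x (hx _ (by omega) (by omega))
        rw [flowUp, Set.indicator_of_mem, a3]
        exact ⟨by omega, by omega⟩
      · intro s hs y hy
        have hs' := hpk s hs
        by_cases hyx : y = x
        · rw [hyx, jump_down_val x hs'.1, hs'.2]; ring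
        · rw [jump_val_of_ne _ _ _ hyx, hs y hy, Function.update_of_ne hyx]
      · intro s hs hs'
        refine Set.indicator_of_notMem (fun hp => hs' fun y hy => ?_) _
        by_cases hyx : y = x
        · have := hs y hy
          rw [hyx, jump_down_val x hp] at this
          rw [hyx, Function.update_self]; omega
        · have := hs y hy
          rw [jump_val_of_ne _ _ _ hyx] at this
          rw [Function.update_of_ne hyx, this]
      · intro s hs
        have hs' := hpk s hs
        rw [flowDown, Set.indicator_of_mem hs'.1, hs'.2]
    · rw [lintegral_flow_const (T := ∅) (c := 0) hJ .empty (by simp),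
        lintegral_flow_const (T := ∅) (c := 0) hC .empty (by simp)]
      · intro s hs _
        refine Set.indicator_of_notMem (fun hp => hv ?_) _
        rw [← hs x (hx _ (by omega) (by omega)), ← hs (x - 1) (hx _ (by omega) (by omega)),
          ← hs (x + 1) (hx _ (by omega) (by omega))]
        exact hp
      · simp
      · intro s hs _
        refine Set.indicator_of_notMem (fun hp => hv ?_) _
        have a1 := hs (x - 1) (hx _ (by omega) (by omega))
        have a2 := hs (x + 1) (hx _ (by omega) (by omega))
        have a3 := hs x (hx _ (by omega) (by omega))
        rw [jump_val_of_ne _ _ _ (by omega)] at a1 a2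
        rw [jump_down_val x hp] at a3
        have := hp.1
        have := hp.2
        omega
      · simp

lemma IsStationaryInitialData.integral_flowDown {μ : Measure HeightFunction}
    (hμ : IsStationaryInitialData q α μ) (hq : 0 < q) (hq1 : q < 1) (hα : 0 < α) (x : ℤ)
    {g : HeightFunction → ℝ} (hg : Measurable g) :
    ∫ s, flowDown q α x s * g (jump x (-2) s) ∂μ = ∫ s, flowUp q α x s * g s ∂μ := by
  have key := congrArg (fun ν => ∫ s, g s ∂ν) (hμ.map_flowDown hq hq1 hα x)
  rw [integral_map (measurable_jump x (-2)).aemeasurable hg.aestronglyMeasurable,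
    integral_withDensity_eq_integral_toReal_smul (measurable_flowDown x).ennreal_ofReal
      (ae_of_all _ fun _ => ENNReal.ofReal_lt_top),
    integral_withDensity_eq_integral_toReal_smul (measurable_flowUp x).ennreal_ofReal
      (ae_of_all _ fun _ => ENNReal.ofReal_lt_top)] at key
  simpa only [ENNReal.toReal_ofReal (flowDown_nonneg hq hα x _),
    ENNReal.toReal_ofReal (flowUp_nonneg hq hα x _), smul_eq_mul] using key

/-- The part of the generator that updates site `x`. -/
noncomputable def siteGenerator (q α : ℝ) (x : ℤ) (f : HeightFunction → ℝ) (s : HeightFunction) :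
    ℝ :=
  rateDown q α (s.1 x) * (f (jump x (-2) s) - f s) + rateUp q α (s.1 x) * (f (jump x 2 s) - f s)

/-- A suppressed jump contributes nothing, so the rates may be cut off to peaks and valleys. -/
lemma siteGenerator_eq (x : ℤ) (f : HeightFunction → ℝ) (s : HeightFunction) :
    siteGenerator q α x f s = flowDown q α x s * f (jump x (-2) s) - flowDown q α x s * f s
      + (flowUp q α x s * f (jump x 2 s) - flowUp q α x s * f s) := by
  unfold siteGenerator flowDown flowUp
  by_cases h1 : s ∈ peak x <;> by_cases h2 : s ∈ valley x
  · rw [Set.indicator_of_mem h1, Set.indicator_of_mem h2]; ring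
  · rw [Set.indicator_of_mem h1, Set.indicator_of_notMem h2, jump_up_of_not_valley h2]; ring
  · rw [Set.indicator_of_notMem h1, Set.indicator_of_mem h2, jump_down_of_not_peak h1]; ring
  · rw [Set.indicator_of_notMem h1, Set.indicator_of_notMem h2, jump_down_of_not_peak h1,
      jump_up_of_not_valley h2]; ring

lemma measurable_siteGenerator (x : ℤ) {f : HeightFunction → ℝ} (hf : Measurable f) :
    Measurable (siteGenerator q α x f) :=
  ((measurable_comp_height _ x).mul ((hf.comp (measurable_jump x _)).sub hf)).add
    ((measurable_comp_height _ x).mul ((hf.comp (measurable_jump x _)).sub hf))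

lemma abs_siteGenerator_le (hq : 0 < q) (hq1 : q < 1) (hα : 0 < α) (x : ℤ)
    {f : HeightFunction → ℝ} {C : ℝ} (hC : ∀ s, |f s| ≤ C) (s : HeightFunction) :
    |siteGenerator q α x f s| ≤ 4 * C := by
  have key : ∀ r a b : ℝ, 0 ≤ r → r ≤ 1 → |a| ≤ C → |b| ≤ C → |r * (a - b)| ≤ 2 * C := by
    intro r a b h0 h1 ha hb
    rw [abs_mul, abs_of_nonneg h0]
    have : |a - b| ≤ 2 * C := (abs_sub _ _).trans (by linarith)
    nlinarith [abs_nonneg (a - b)]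
  have h1 := key _ _ _ (rateDown_nonneg hq hα (s.1 x)) (rateDown_le_one hq hq1 hα _)
    (hC (jump x (-2) s)) (hC s)
  have h2 := key _ _ _ (rateUp_nonneg hq hα (s.1 x)) (rateUp_le_one hq hq1 hα _)
    (hC (jump x 2 s)) (hC s)
  exact (abs_add_le _ _).trans (by linarith)

/-- Flow balance is applied to `f` and to `f` after an upward jump. The first matches gains from
peaks with losses from valleys; the second, since the upward jump undoes the downward one, matches
losses from peaks with gains from valleys. -/
lemma IsStationaryInitialData.integral_siteGenerator {μ : Measure HeightFunction}
    (hμ : IsStationaryInitialData q α μ) (hq : 0 < q) (hq1 : q < 1) (hα : 0 < α) (x : ℤ)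
    {f : HeightFunction → ℝ} (hf : Measurable f) {C : ℝ} (hC : ∀ s, |f s| ≤ C) :
    ∫ s, siteGenerator q α x f s ∂μ = 0 := by
  have := hμ.isProbabilityMeasure
  have hint : ∀ φ g : HeightFunction → ℝ, Measurable φ → Measurable g → (∀ s, 0 ≤ φ s) →
      (∀ s, φ s ≤ 1) → (∀ s, |g s| ≤ C) → Integrable (fun s => φ s * g s) μ := by
    intro φ g hφ hg h0 h1 hgC
    refine Integrable.of_bound (C := C) (hφ.mul hg).aestronglyMeasurable (ae_of_all _ fun s => ?_)
    rw [Real.norm_eq_abs, abs_mul, abs_of_nonneg (h0 s)]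
    nlinarith [hgC s, h0 s, h1 s, abs_nonneg (g s)]
  have i1 := hint _ _ (measurable_flowDown x) (hf.comp (measurable_jump x (-2)))
    (flowDown_nonneg hq hα x) (flowDown_le_one hq hq1 hα x) fun s => hC _
  have i2 := hint _ _ (measurable_flowDown x) hf
    (flowDown_nonneg hq hα x) (flowDown_le_one hq hq1 hα x) hC
  have i3 := hint _ _ (measurable_flowUp x) (hf.comp (measurable_jump x 2))
    (flowUp_nonneg hq hα x) (flowUp_le_one hq hq1 hα x) fun s => hC _
  have i4 := hint _ _ (measurable_flowUp x) hf
    (flowUp_nonneg hq hα x) (flowUp_le_one hq hq1 hα x) hC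
  have e1 := hμ.integral_flowDown hq hq1 hα x hf
  have e2 := hμ.integral_flowDown hq hq1 hα x (hf.comp (measurable_jump x 2))
  have e3 : ∫ s, flowDown q α x s * (f ∘ jump x 2) (jump x (-2) s) ∂μ =
      ∫ s, flowDown q α x s * f s ∂μ := by
    refine integral_congr_ae (ae_of_all _ fun s => ?_)
    by_cases hs : s ∈ peak x
    · simp only [Function.comp, jump_up_jump_down hs]
    · simp [flowDown, hs]
  rw [e3] at e2
  simp only [Function.comp_def] at i1 i3 e2
  simp only [siteGenerator_eq]
  rw [integral_add (by exact i1.sub i2) (by exact i3.sub i4), integral_sub i1 i2, integral_sub i3 i4]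
  linarith

end DynamicASEP

/-! ### Local functions and uniqueness for the forward equation -/

namespace DynamicASEP

variable {q α : ℝ}

/-- The function `f` only depends on the heights in `[-n, n]`. -/
def LocalOn (n : ℕ) (f : HeightFunction → ℝ) : Prop :=
  ∀ s t : HeightFunction, (∀ x ∈ Finset.Icc (-n : ℤ) n, s.1 x = t.1 x) → f s = f t

lemma LocalOn.isLocal {n : ℕ} {f : HeightFunction → ℝ} (hf : LocalOn n f) : IsLocal f := ⟨_, hf⟩

lemma LocalOn.continuous {n : ℕ} {f : HeightFunction → ℝ} (hf : LocalOn n f) : Continuous f := by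
  refine continuous_iff_continuousAt.2 fun s => ?_
  have : ∀ᶠ t in 𝓝 s, ∀ x ∈ Finset.Icc (-n : ℤ) n, t.1 x = s.1 x := by
    rw [Filter.eventually_all_finset]
    intro x _
    have hc : Continuous fun t : HeightFunction => t.1 x :=
      (continuous_apply x).comp continuous_subtype_val
    exact hc.continuousAt.eventually (p := fun y => y = s.1 x)
      (eventually_of_mem (mem_nhds_discrete.2 (Set.mem_singleton _)) fun y hy => hy)
  exact continuousAt_const.congr (this.mono fun t ht => (hf t s ht).symm)

lemma LocalOn.measurable {n : ℕ} {f : HeightFunction → ℝ} (hf : LocalOn n f) : Measurable f :=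
  hf.continuous.measurable

lemma LocalOn.generator_eq {n : ℕ} {f : HeightFunction → ℝ} (hf : LocalOn n f)
    (s : HeightFunction) :
    generator q α f s = ∑ x ∈ Finset.Icc (-n : ℤ) n, siteGenerator q α x f s := by
  refine tsum_eq_sum fun x hx => ?_
  have : ∀ c, f (jump x c s) = f s := fun c =>
    hf _ _ fun y hy => jump_val_of_ne _ _ _ fun h => hx (h ▸ hy)
  rw [this, this]; ring

/-- Whether a jump at `x` is allowed depends on `x - 1` and `x + 1`, so the window grows by one. -/
lemma LocalOn.generator {n : ℕ} {f : HeightFunction → ℝ} (hf : LocalOn n f) :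
    LocalOn (n + 1) (generator q α f) := by
  intro s t hst
  rw [hf.generator_eq, hf.generator_eq]
  refine Finset.sum_congr rfl fun x hx => ?_
  rw [Finset.mem_Icc] at hx
  have key : ∀ y, x - 1 ≤ y → y ≤ x + 1 → s.1 y = t.1 y := fun y h1 h2 =>
    hst y (Finset.mem_Icc.2 ⟨by push_cast; omega, by push_cast; omega⟩)
  have hj : ∀ c, f (jump x c s) = f (jump x c t) := by
    intro c
    refine hf _ _ fun y hy => ?_
    by_cases hyx : y = x
    · rw [hyx, jump_val_self, jump_val_self, key x (by omega) (by omega),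
        key (x - 1) (by omega) (by omega), key (x + 1) (by omega) (by omega)]
    · rw [jump_val_of_ne _ _ _ hyx, jump_val_of_ne _ _ _ hyx]
      rw [Finset.mem_Icc] at hy
      exact hst y (Finset.mem_Icc.2 ⟨by push_cast; omega, by push_cast; omega⟩)
  have hf' : f s = f t := hf _ _ fun y hy => by
    rw [Finset.mem_Icc] at hy
    exact hst y (Finset.mem_Icc.2 ⟨by push_cast; omega, by push_cast; omega⟩)
  rw [siteGenerator, siteGenerator, hj, hj, hf', key x (by omega) (by omega)]

/-- There are `2 n + 1` sites, each contributing at most `4 C`. Rounding up to a multiple of `n + 1`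
makes the iterated bound a binomial coefficient. -/
lemma LocalOn.abs_generator_le (hq : 0 < q) (hq1 : q < 1) (hα : 0 < α) {n : ℕ}
    {f : HeightFunction → ℝ} (hf : LocalOn n f) {C : ℝ} (hC : ∀ s, |f s| ≤ C)
    (s : HeightFunction) : |DynamicASEP.generator q α f s| ≤ 8 * (n + 1) * C := by
  rw [hf.generator_eq]
  have h0 : 0 ≤ C := (abs_nonneg _).trans (hC s)
  refine (Finset.abs_sum_le_sum_abs _ _).trans ((Finset.sum_le_card_nsmul _ _ _ fun x _ =>
    abs_siteGenerator_le hq hq1 hα x hC s).trans ?_)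
  rw [Int.card_Icc, nsmul_eq_mul, show ((n : ℤ) + 1 - -n).toNat = 2 * n + 1 by omega]
  push_cast
  nlinarith

lemma IsStationaryInitialData.integral_generator {μ : Measure HeightFunction}
    (hμ : IsStationaryInitialData q α μ) (hq : 0 < q) (hq1 : q < 1) (hα : 0 < α) {n : ℕ}
    {f : HeightFunction → ℝ} (hf : LocalOn n f) {C : ℝ} (hC : ∀ s, |f s| ≤ C) :
    ∫ s, generator q α f s ∂μ = 0 := by
  have := hμ.isProbabilityMeasure
  simp only [hf.generator_eq]
  rw [integral_finsetSum]
  · exact Finset.sum_eq_zero fun x _ => hμ.integral_siteGenerator hq hq1 hα x hf.measurable hC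
  · intro x _
    exact Integrable.of_bound (C := 4 * C)
      (measurable_siteGenerator x hf.measurable).aestronglyMeasurable
      (ae_of_all _ fun s => abs_siteGenerator_le hq hq1 hα x hC s)

/-- A family of functionals that starts at zero and solves the forward equation vanishes for small
times. -/
lemma forward_bound (hq : 0 < q) (hq1 : q < 1) (hα : 0 < α) {D : (HeightFunction → ℝ) → ℝ → ℝ}
    (hb : ∀ n f C, LocalOn n f → (∀ s, |f s| ≤ C) → ∀ t, |D f t| ≤ 2 * C)
    (hD : ∀ n f C, LocalOn n f → (∀ s, |f s| ≤ C) → ∀ t, 0 ≤ t →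
      D f t = ∫ r in (0 : ℝ)..t, D (generator q α f) r) (k : ℕ) :
    ∀ n f C, LocalOn n f → (∀ s, |f s| ≤ C) → ∀ t, 0 ≤ t →
      |D f t| ≤ 2 * C * (8 * t) ^ k * (n + k).choose k := by
  induction k with
  | zero =>
    intro n f C hf hC t _
    simpa using hb n f C hf hC t
  | succ k ih =>
    intro n f C hf hC t ht
    rw [hD n f C hf hC t ht]
    have hL := ih (n + 1) _ _ hf.generator (hf.abs_generator_le hq hq1 hα hC)
    have h1 : ‖∫ r in (0 : ℝ)..t, D (generator q α f) r‖ ≤ ∫ r in (0 : ℝ)..t,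
        2 * (8 * (n + 1) * C) * (8 * r) ^ k * ((n + 1 + k).choose k : ℝ) := by
      refine intervalIntegral.norm_integral_le_of_norm_le ht (ae_of_all _ fun r hr => hL r hr.1.le)
        (Continuous.intervalIntegrable (by fun_prop) _ _)
    refine h1.trans (le_of_eq ?_)
    -- The factor `n + 1` from the generator and `1 / (k + 1)` from integrating `r ^ k` raise the
    -- binomial coefficient by one level.
    have h2 : ((n + 1 + k).choose k : ℝ) * (n + 1) = (n + (k + 1)).choose (k + 1) * (k + 1) := by
      have := Nat.choose_succ_right_eq (n + 1 + k) k
      rw [show n + 1 + k - k = n + 1 by omega] at this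
      rw [show n + (k + 1) = n + 1 + k by omega]
      exact_mod_cast this.symm
    have h3 : ∫ r in (0 : ℝ)..t, r ^ k = t ^ (k + 1) / (k + 1) := by simp [integral_pow]
    have h4 : (fun r : ℝ => 2 * (8 * (n + 1) * C) * (8 * r) ^ k * ((n + 1 + k).choose k : ℝ)) =
        fun r => (2 * C * 8 ^ (k + 1) * (((n + 1 + k).choose k : ℝ) * (n + 1))) * r ^ k := by
      funext r; rw [mul_pow]; ring
    rw [h4, intervalIntegral.integral_const_mul, h3, h2, mul_pow]
    have : (k + 1 : ℝ) ≠ 0 := by positivity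
    field_simp

/-- With `binom(n + k, k) ≤ 2^(n + k)` and `8 t ≤ 1/4`, the bounds decay like `2^(-k)`. -/
lemma forward_eq_zero (hq : 0 < q) (hq1 : q < 1) (hα : 0 < α) {D : (HeightFunction → ℝ) → ℝ → ℝ}
    (hb : ∀ n f C, LocalOn n f → (∀ s, |f s| ≤ C) → ∀ t, |D f t| ≤ 2 * C)
    (hD : ∀ n f C, LocalOn n f → (∀ s, |f s| ≤ C) → ∀ t, 0 ≤ t →
      D f t = ∫ r in (0 : ℝ)..t, D (generator q α f) r)
    {n : ℕ} {f : HeightFunction → ℝ} {C : ℝ} (hf : LocalOn n f) (hC : ∀ s, |f s| ≤ C) {t : ℝ}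
    (ht : 0 ≤ t) (ht' : t ≤ 1 / 32) : D f t = 0 := by
  have hC0 : 0 ≤ C := by linarith [(abs_nonneg _).trans (hb n f C hf hC 0)]
  have h1 : ∀ k : ℕ, |D f t| ≤ 2 * C * 2 ^ n * (1 / 2) ^ k := by
    intro k
    refine (forward_bound hq hq1 hα hb hD k n f C hf hC t ht).trans ?_
    have e1 : (8 * t) ^ k ≤ (1 / 4) ^ k := pow_le_pow_left₀ (by positivity) (by linarith) k
    have e2 : ((n + k).choose k : ℝ) ≤ 2 ^ (n + k) := by
      exact_mod_cast Nat.choose_le_two_pow (n + k) k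
    calc 2 * C * (8 * t) ^ k * (n + k).choose k ≤ 2 * C * (1 / 4) ^ k * 2 ^ (n + k) := by gcongr
      _ = 2 * C * 2 ^ n * ((1 / 4) * 2) ^ k := by rw [mul_pow, pow_add]; ring
      _ = _ := by norm_num
  have h2 : Tendsto (fun k : ℕ => 2 * C * 2 ^ n * (1 / 2 : ℝ) ^ k) atTop (𝓝 (2 * C * 2 ^ n * 0)) :=
    (tendsto_pow_atTop_nhds_zero_of_lt_one (by norm_num) (by norm_num)).const_mul _
  rw [mul_zero] at h2
  exact abs_eq_zero.1 (le_antisymm (ge_of_tendsto' h2 h1) (abs_nonneg _))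

/-! ### Expectations along the dynamics -/

section Evolution

variable {Ω : Type*} {mΩ : MeasurableSpace Ω} {P : Measure Ω} {ℱ : Filtration ℝ≥0 mΩ}
  {X : ℝ≥0 → Ω → HeightFunction}

/-- A process with right-continuous paths is jointly measurable. -/
lemma measurable_uncurry_of_rightContinuous {Y : ℝ≥0 → Ω → ℝ} (hm : ∀ t, Measurable (Y t))
    (hc : ∀ ω t, ContinuousWithinAt (fun r => Y r ω) (Set.Ici t) t) :
    Measurable fun p : ℝ≥0 × Ω => Y p.1 p.2 := by
  -- Time is rounded strictly up to the grid of mesh `1 / (n + 1)`. Each approximation reads the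
  -- process at countably many times, and right-continuity gives convergence.
  refine measurable_of_tendsto_metrizable (f := fun (n : ℕ) (p : ℝ≥0 × Ω) =>
    Y (((⌊((n : ℝ≥0) + 1) * p.1⌋₊ : ℝ≥0) + 1) / (n + 1)) p.2) (fun n => ?_)
    (tendsto_pi_nhds.2 fun p => ?_)
  · have h1 : Measurable fun z : ℕ × Ω => Y (((z.1 : ℝ≥0) + 1) / (n + 1)) z.2 :=
      measurable_from_prod_countable_right fun k => hm (((k : ℝ≥0) + 1) / (n + 1))
    have h2 : Measurable fun p : ℝ≥0 × Ω => (⌊((n : ℝ≥0) + 1) * p.1⌋₊, p.2) :=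
      (Nat.measurable_floor.comp (by fun_prop)).prodMk measurable_snd
    have h3 := h1.comp h2
    simp only [Function.comp_def] at h3
    exact h3
  · obtain ⟨r, ω⟩ := p
    refine (hc ω r).tendsto.comp (tendsto_nhdsWithin_iff.2 ⟨?_, Eventually.of_forall fun n => ?_⟩)
    · have h0 : Tendsto (fun n : ℕ => r + 1 / ((n : ℝ≥0) + 1)) atTop (𝓝 (r + 0)) :=
        tendsto_const_nhds.add tendsto_one_div_add_atTop_nhds_zero_nat
      rw [add_zero] at h0
      refine tendsto_of_tendsto_of_tendsto_of_le_of_le tendsto_const_nhds h0 (fun n => ?_)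
        fun n => ?_
      · have hn : (0 : ℝ≥0) < n + 1 := by positivity
        dsimp only
        rw [le_div_iff₀ hn, mul_comm]
        exact (Nat.lt_floor_add_one _).le
      · have hn : (0 : ℝ≥0) < n + 1 := by positivity
        dsimp only
        rw [div_le_iff₀ hn, add_mul r, one_div, inv_mul_cancel₀ hn.ne', mul_comm r]
        gcongr
        exact Nat.floor_le (by positivity)
    · have hn : (0 : ℝ≥0) < n + 1 := by positivity
      rw [Set.mem_Ici, le_div_iff₀ hn, mul_comm]
      exact (Nat.lt_floor_add_one _).le

lemma IsDynamicASEP.measurable (hX : IsDynamicASEP q α P ℱ X) (t : ℝ≥0) : Measurable (X t) :=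
  (hX.adapted t).mono (ℱ.le t) le_rfl

lemma IsDynamicASEP.measurable_uncurry (hX : IsDynamicASEP q α P ℱ X) {n : ℕ}
    {f : HeightFunction → ℝ} (hf : LocalOn n f) :
    Measurable fun p : ℝ × Ω => f (X p.1.toNNReal p.2) := by
  have h := measurable_uncurry_of_rightContinuous (Y := fun t ω => f (X t ω))
    (fun t => hf.measurable.comp (hX.measurable t))
    fun ω t => hf.continuous.continuousAt.comp_continuousWithinAt (hX.rightContinuous ω t)
  exact h.comp ((measurable_real_toNNReal.comp measurable_fst).prodMk measurable_snd)

lemma IsDynamicASEP.forward [IsProbabilityMeasure P] (hq : 0 < q) (hq1 : q < 1) (hα : 0 < α)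
    (hX : IsDynamicASEP q α P ℱ X) {n : ℕ} {f : HeightFunction → ℝ} {C : ℝ} (hf : LocalOn n f)
    (hC : ∀ s, |f s| ≤ C) (t : ℝ≥0) :
    ∫ ω, f (X t ω) ∂P = ∫ ω, f (X 0 ω) ∂P +
      ∫ r in (0 : ℝ)..t, ∫ ω, generator q α f (X r.toNNReal ω) ∂P := by
  have hmart := hX.martingale f hf.isLocal ⟨C, hC⟩
  have h1 := hmart.setIntegral_eq (zero_le : 0 ≤ t) MeasurableSet.univ
  simp only [setIntegral_univ, NNReal.coe_zero, intervalIntegral.integral_same, sub_self,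
    integral_zero] at h1
  have hg := hX.measurable_uncurry (hf.generator (q := q) (α := α))
  have hgb := hf.abs_generator_le hq hq1 hα hC
  have hint : ∀ t, Integrable (fun ω => f (X t ω)) P := fun t =>
    Integrable.of_bound (C := C) (hf.measurable.comp (hX.measurable t)).aestronglyMeasurable
      (ae_of_all _ fun ω => hC _)
  have : IsFiniteMeasure (volume.restrict (Set.uIoc 0 (t : ℝ))) := by
    unfold Set.uIoc; infer_instance
  have hprod : Integrable (Function.uncurry fun (r : ℝ) ω => generator q α f (X r.toNNReal ω))
      ((volume.restrict (Set.uIoc 0 (t : ℝ))).prod P) :=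
    Integrable.of_bound (C := 8 * (n + 1) * C) hg.aestronglyMeasurable (ae_of_all _ fun p => hgb _)
  -- The time integral is a difference of the bounded increment of `f` and the martingale, hence
  -- integrable.
  have hI : Integrable (fun ω => ∫ r in (0 : ℝ)..t, generator q α f (X r.toNNReal ω)) P := by
    have := (hint t).sub (hint 0) |>.sub (hmart.integrable t)
    refine this.congr (ae_of_all _ fun ω => ?_)
    simp
  rw [integral_sub (by exact (hint t).sub (hint 0)) hI, integral_sub (hint t) (hint 0)] at h1
  rw [intervalIntegral_integral_swap hprod]
  linarith

lemma IsDynamicASEP.intervalIntegrable [IsProbabilityMeasure P]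
    (hX : IsDynamicASEP q α P ℱ X) {n : ℕ} {f : HeightFunction → ℝ} {C : ℝ} (hf : LocalOn n f)
    (hC : ∀ s, |f s| ≤ C) (a b : ℝ) :
    IntervalIntegrable (fun r => ∫ ω, f (X r.toNNReal ω) ∂P) volume a b := by
  have h1 : StronglyMeasurable fun r : ℝ => ∫ ω, f (X r.toNNReal ω) ∂P :=
    (hX.measurable_uncurry hf).stronglyMeasurable.integral_prod_right
  refine (intervalIntegrable_const (c := C)).mono_fun h1.aestronglyMeasurable
    (ae_of_all _ fun r => ?_)
  refine (norm_integral_le_of_norm_le_const (ae_of_all _ fun ω => hC _)).trans ?_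
  simpa using le_abs_self C

/-- Expectations of bounded local functions do not change in time if the process starts from
stationary initial data. -/
lemma IsDynamicASEP.integral_eq [IsProbabilityMeasure P] (hq : 0 < q) (hq1 : q < 1) (hα : 0 < α)
    (hX : IsDynamicASEP q α P ℱ X) {μ : Measure HeightFunction}
    (hμ : IsStationaryInitialData q α μ) (h0 : P.map (X 0) = μ) (j : ℕ) :
    ∀ t : ℝ, 0 ≤ t → t ≤ j / 32 → ∀ n f C, LocalOn n f → (∀ s, |f s| ≤ C) →
      ∫ ω, f (X t.toNNReal ω) ∂P = ∫ s, f s ∂μ := by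
  have := hμ.isProbabilityMeasure
  have hstart : ∀ n f, LocalOn n f → ∫ ω, f (X 0 ω) ∂P = ∫ s, f s ∂μ := by
    intro n f hf
    rw [← h0, integral_map (hX.measurable 0).aemeasurable hf.measurable.aestronglyMeasurable]
  induction j with
  | zero =>
    intro t ht ht' n f C hf _
    have : t = 0 := le_antisymm (by simpa using ht') ht
    rw [this, Real.toNNReal_zero]
    exact hstart n f hf
  | succ j ih =>
    intro t ht ht' n f C hf hC
    by_cases htj : t ≤ j / 32
    · exact ih t ht htj n f C hf hC
    have hj : (0 : ℝ) ≤ j / 32 := by positivity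
    -- Restart at time `j / 32`, where the defect vanishes by induction. Since `L f` has mean zero
    -- under `μ`, subtracting the stationary mean leaves the forward equation homogeneous.
    have key := forward_eq_zero (q := q) (α := α) hq hq1 hα
      (D := fun f r => ∫ ω, f (X (j / 32 + r).toNNReal ω) ∂P - ∫ s, f s ∂μ) ?_ ?_ hf hC
      (t := t - j / 32) (by linarith) (by push_cast at ht'; linarith)
    · rw [add_sub_cancel] at key
      linarith
    · intro n f C _ hC r
      have b1 : ‖∫ ω, f (X (j / 32 + r).toNNReal ω) ∂P‖ ≤ C := by
        simpa using norm_integral_le_of_norm_le_const (μ := P) (f := fun ω => f (X (j / 32 + r).toNNReal ω))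
          (C := C) (ae_of_all _ fun ω => hC _)
      have b2 : ‖∫ s, f s ∂μ‖ ≤ C := by
        simpa using norm_integral_le_of_norm_le_const (μ := μ) (f := f)
          (C := C) (ae_of_all _ fun s => hC _)
      rw [Real.norm_eq_abs] at b1 b2
      exact (abs_sub _ _).trans (by linarith)
    · intro n f C hf hC r hr
      have f1 := hX.forward hq hq1 hα hf hC (j / 32 + r).toNNReal
      have f2 := hX.forward hq hq1 hα hf hC (j / 32 : ℝ).toNNReal
      rw [ih _ hj le_rfl n f C hf hC, Real.coe_toNNReal _ hj] at f2
      rw [Real.coe_toNNReal _ (by positivity)] at f1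
      have hii := fun a b => hX.intervalIntegrable hf.generator
        (hf.abs_generator_le hq hq1 hα hC) a b
      have f3 := intervalIntegral.integral_add_adjacent_intervals (hii 0 (j / 32))
        (hii (j / 32) (j / 32 + r))
      simp only [hμ.integral_generator hq hq1 hα hf hC, sub_zero]
      rw [intervalIntegral.integral_comp_add_left
        (fun r => ∫ ω, generator q α f (X r.toNNReal ω) ∂P), add_zero]
      linarith

theorem IsDynamicASEP.map_eq [IsProbabilityMeasure P] (hq : 0 < q) (hq1 : q < 1) (hα : 0 < α)
    (hX : IsDynamicASEP q α P ℱ X) {μ : Measure HeightFunction}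
    (hμ : IsStationaryInitialData q α μ) (h0 : P.map (X 0) = μ) (t : ℝ≥0) :
    P.map (X t) = μ := by
  have := hμ.isProbabilityMeasure
  refine ext_of_cyl (F := fun n : ℕ => Finset.Icc (-n : ℤ) n) ?_ ?_ fun n h => ?_
  · intro n m hnm
    exact Finset.Icc_subset_Icc (by omega) (by omega)
  · intro y
    refine ⟨y.natAbs, ?_⟩
    rw [Finset.mem_Icc]
    omega
  · have hC := measurableSet_cyl (Finset.Icc (-n : ℤ) n) h
    have hloc : LocalOn n ((cyl (Finset.Icc (-n : ℤ) n) h).indicator fun _ => (1 : ℝ)) := by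
      intro s s' hs
      have : s ∈ cyl (Finset.Icc (-n : ℤ) n) h ↔ s' ∈ cyl (Finset.Icc (-n : ℤ) n) h :=
        forall₂_congr fun y hy => by rw [hs y hy]
      by_cases h1 : s ∈ cyl (Finset.Icc (-n : ℤ) n) h
      · simp [h1, this.1 h1]
      · simp [h1, mt this.2 h1]
    obtain ⟨j, hj⟩ := exists_nat_ge ((t : ℝ) * 32)
    have key := hX.integral_eq hq hq1 hα hμ h0 j t t.2 (by rw [le_div_iff₀ (by norm_num)]; exact hj)
      n _ 1 hloc fun s => by
        by_cases h1 : s ∈ cyl (Finset.Icc (-n : ℤ) n) h <;> simp [h1]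
    rw [Real.toNNReal_coe, ← integral_map (hX.measurable t).aemeasurable
      hloc.measurable.aestronglyMeasurable, integral_indicator_const _ hC,
      integral_indicator_const _ hC] at key
    have hP : IsProbabilityMeasure (P.map (X t)) :=
      Measure.isProbabilityMeasure_map (hX.measurable t).aemeasurable
    simp only [smul_eq_mul, mul_one] at key
    rwa [measureReal_eq_measureReal_iff] at key

end Evolution

end DynamicASEP

/-! ### The Jacobi triple product -/

namespace DynamicASEP

variable {q z : ℝ}

/-- The terms `z ^ j q ^ (j (j - 1) / 2)` of the theta series. -/
noncomputable def thetaTerm (q z : ℝ) (j : ℤ) : ℝ := z ^ j * q ^ (j * (j - 1) / 2)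

lemma thetaTerm_pos (hq : 0 < q) (hz : 0 < z) (j : ℤ) : 0 < thetaTerm q z j := by
  unfold thetaTerm; positivity

lemma thetaTerm_add_one (hq : 0 < q) (hz : 0 < z) (j : ℤ) :
    thetaTerm q z (j + 1) = z * q ^ j * thetaTerm q z j := by
  have : (j + 1) * (j + 1 - 1) / 2 = j * (j - 1) / 2 + j := by
    rw [show (j + 1) * (j + 1 - 1) = j * (j - 1) + j * 2 by ring,
      Int.add_mul_ediv_right _ _ two_ne_zero]
  rw [thetaTerm, thetaTerm, this, zpow_add_one₀ hz.ne', zpow_add₀ hq.ne']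
  ring

lemma summable_thetaTerm (hq : 0 < q) (hq1 : q < 1) (hz : 0 < z) : Summable (thetaTerm q z) := by
  have hlim : ∀ c : ℝ, Tendsto (fun n : ℕ => c * q ^ n) atTop (𝓝 0) := fun c => by
    simpa using (tendsto_pow_atTop_nhds_zero_of_lt_one hq.le hq1).const_mul c
  refine Summable.of_nat_of_neg_add_one ?_ ?_
  · refine summable_of_ratio_test_tendsto_lt_one zero_lt_one
      (Eventually.of_forall fun n => (thetaTerm_pos hq hz n).ne') ((hlim z).congr fun n => ?_)
    have := thetaTerm_pos hq hz n
    rw [Nat.cast_succ, thetaTerm_add_one hq hz, Real.norm_of_nonneg (by positivity),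
      Real.norm_of_nonneg (by positivity), zpow_natCast]
    field_simp
  · refine summable_of_ratio_test_tendsto_lt_one zero_lt_one
      (Eventually.of_forall fun n => (thetaTerm_pos hq hz _).ne')
      ((hlim (z⁻¹ * q ^ 2)).congr fun n => ?_)
    have h0 := thetaTerm_pos hq hz (-((n + 1 : ℕ) + 1 : ℤ))
    have h1 := thetaTerm_add_one hq hz (-((n + 1 : ℕ) + 1 : ℤ))
    rw [show (-((n + 1 : ℕ) + 1 : ℤ) + 1) = -(n + 1 : ℤ) by push_cast; ring] at h1
    rw [h1, Real.norm_of_nonneg (by positivity), Real.norm_of_nonneg (by positivity)]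
    have : q ^ (-((n + 1 : ℕ) + 1 : ℤ)) = (q ^ n * q ^ 2)⁻¹ := by
      rw [zpow_neg, ← pow_add, ← zpow_natCast]; push_cast; ring_nf
    rw [this]
    have : thetaTerm q z (-((n + 1 : ℕ) + 1 : ℤ)) ≠ 0 := h0.ne'
    field_simp

/-- The finite `q`-Pochhammer symbol `(q; q)_n`. -/
noncomputable def qFactorial (q : ℝ) (n : ℕ) : ℝ := ∏ k ∈ Finset.range n, (1 - q * q ^ k)

lemma qFactorial_succ (q : ℝ) (n : ℕ) :
    qFactorial q (n + 1) = qFactorial q n * (1 - q ^ (n + 1)) := by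
  rw [qFactorial, Finset.prod_range_succ, ← qFactorial, pow_succ']

lemma one_sub_pow_pos (hq : 0 < q) (hq1 : q < 1) (n : ℕ) : 0 < 1 - q ^ (n + 1) :=
  sub_pos.2 (pow_lt_one₀ hq.le hq1 (Nat.succ_ne_zero n))

lemma qFactorial_pos (hq : 0 < q) (hq1 : q < 1) (n : ℕ) : 0 < qFactorial q n := by
  induction n with
  | zero => simp [qFactorial]
  | succ n ih => rw [qFactorial_succ]; exact mul_pos ih (one_sub_pow_pos hq hq1 n)

lemma qFactorial_antitone (hq : 0 < q) (hq1 : q < 1) : Antitone (qFactorial q) := by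
  refine antitone_nat_of_succ_le fun n => ?_
  rw [qFactorial_succ]
  exact mul_le_of_le_one_right (qFactorial_pos hq hq1 n).le (by linarith [pow_pos hq (n + 1)])

/-- The reciprocal of `(q; q)_n`, extended by zero to negative `n`. -/
noncomputable def invQFactorial (q : ℝ) (n : ℤ) : ℝ :=
  if 0 ≤ n then (qFactorial q n.toNat)⁻¹ else 0

lemma invQFactorial_nonneg (hq : 0 < q) (hq1 : q < 1) (n : ℤ) : 0 ≤ invQFactorial q n := by
  unfold invQFactorial
  split_ifs
  · exact (inv_pos.2 (qFactorial_pos hq hq1 _)).le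
  · rfl

/-- Extension by zero keeps the recursion valid on all integers: at `n = -1` the factor `1 - q^0`
vanishes. No boundary cases arise for the triple product coefficients. -/
lemma invQFactorial_eq (hq : 0 < q) (hq1 : q < 1) (n : ℤ) :
    invQFactorial q n = (1 - q ^ (n + 1)) * invQFactorial q (n + 1) := by
  rcases lt_trichotomy n (-1) with h | h | h
  · rw [invQFactorial, invQFactorial, if_neg (by omega), if_neg (by omega), mul_zero]
  · subst h
    simp [invQFactorial]
  · lift n to ℕ using by omega
    have h1 := qFactorial_pos hq hq1 n
    have h2 := one_sub_pow_pos hq hq1 n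
    rw [invQFactorial, invQFactorial, if_pos (by omega), if_pos (by omega),
      show (n + 1 : ℤ).toNat = n + 1 by omega, Int.toNat_natCast, qFactorial_succ]
    rw [show (n + 1 : ℤ) = ((n + 1 : ℕ) : ℤ) by push_cast; rfl, zpow_natCast]
    field_simp

/-- The coefficients of the finite form of the Jacobi triple product. -/
noncomputable def tripleCoeff (q z : ℝ) (N : ℕ) (j : ℤ) : ℝ :=
  qFactorial q (2 * N) * invQFactorial q (N + j) * invQFactorial q (N - j) * thetaTerm q z j

/-- The `q`-Pascal rule applied twice, matching the expansion of `(1 + z q^N) (1 + z⁻¹ q^(N+1))`,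
the factors gained in passing from `N` to `N + 1`. -/
lemma tripleCoeff_succ (hq : 0 < q) (hq1 : q < 1) (hz : 0 < z) (N : ℕ) (j : ℤ) :
    tripleCoeff q z (N + 1) j = (1 + q ^ (2 * N + 1)) * tripleCoeff q z N j +
      z * q ^ N * tripleCoeff q z N (j - 1) + z⁻¹ * q ^ (N + 1) * tripleCoeff q z N (j + 1) := by
  have a1 := invQFactorial_eq hq hq1 (N + j)
  have a2 := invQFactorial_eq hq hq1 (N + j - 1)
  have b1 := invQFactorial_eq hq hq1 (N - j)
  have b2 := invQFactorial_eq hq hq1 (N - j - 1)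
  have t1 := thetaTerm_add_one hq hz j
  have t2 := thetaTerm_add_one hq hz (j - 1)
  rw [sub_add_cancel] at a2 b2 t2
  have t3 : thetaTerm q z (j - 1) = (z * q ^ (j - 1))⁻¹ * thetaTerm q z j := by
    rw [t2]; field_simp
  unfold tripleCoeff
  rw [show 2 * (N + 1) = 2 * N + 1 + 1 by ring, qFactorial_succ, qFactorial_succ,
    show ((N + 1 : ℕ) + j : ℤ) = N + j + 1 by push_cast; ring,
    show ((N + 1 : ℕ) - j : ℤ) = N - j + 1 by push_cast; ring,
    show (N + (j - 1) : ℤ) = N + j - 1 by ring, show (N - (j - 1) : ℤ) = N - j + 1 by ring,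
    show (N + (j + 1) : ℤ) = N + j + 1 by ring, show (N - (j + 1) : ℤ) = N - j - 1 by ring,
    a2, b2, a1, b1, t1, t3]
  rw [zpow_add_one₀ hq.ne', zpow_add_one₀ hq.ne', zpow_sub_one₀ hq.ne', zpow_add₀ hq.ne',
    zpow_sub₀ hq.ne', zpow_natCast]
  rw [pow_succ q (2 * N + 1), pow_succ q (2 * N), pow_mul', sq, pow_succ q N]
  have hu : q ^ j ≠ 0 := zpow_ne_zero _ hq.ne'
  generalize q ^ j = u at hu
  generalize q ^ N = w
  generalize invQFactorial q (N + j + 1) = R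
  generalize invQFactorial q (N - j + 1) = S
  generalize qFactorial q (2 * N) = T
  generalize thetaTerm q z j = θ
  have hq0 := hq.ne'
  have hz0 := hz.ne'
  field_simp
  ring

/-- The finite triple product: the coefficient of `z^j` is `q^(j(j-1)/2)` times the `q`-binomial
`2N` over `N + j`. -/
lemma hasSum_tripleCoeff (hq : 0 < q) (hq1 : q < 1) (hz : 0 < z) (N : ℕ) :
    HasSum (tripleCoeff q z N)
      ((∏ k ∈ Finset.range N, (1 + z * q ^ k)) *
        ∏ k ∈ Finset.range N, (1 + z⁻¹ * q * q ^ k)) := by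
  induction N with
  | zero =>
    have : tripleCoeff q z 0 = fun j => if j = 0 then 1 else 0 := by
      funext j
      rcases lt_trichotomy j 0 with h | h | h
      · rw [tripleCoeff, invQFactorial, if_neg (by simpa using h), if_neg h.ne]; ring
      · subst h
        simp [tripleCoeff, invQFactorial, qFactorial, thetaTerm]
      · rw [tripleCoeff, invQFactorial, invQFactorial, if_neg (c := (0 : ℤ) ≤ (0 : ℕ) - j)
          (by simpa using h), if_neg h.ne']; ring
    rw [this]
    simpa using hasSum_ite_eq (0 : ℤ) (1 : ℝ)
  | succ N ih =>
    have h1 := ((Equiv.subRight (1 : ℤ)).hasSum_iff.2 ih).mul_left (z * q ^ N)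
    have h2 := ((Equiv.addRight (1 : ℤ)).hasSum_iff.2 ih).mul_left (z⁻¹ * q ^ (N + 1))
    have h3 := ((ih.mul_left (1 + q ^ (2 * N + 1))).add h1).add h2
    rw [funext (tripleCoeff_succ hq hq1 hz N), Finset.prod_range_succ, Finset.prod_range_succ]
    refine (congrArg (HasSum _) ?_).mp h3
    field_simp
    ring

lemma multipliable_qPochhammer (hq : 0 < q) (hq1 : q < 1) (a : ℝ) :
    Multipliable fun k : ℕ => 1 - a * q ^ k := by
  have := Real.multipliable_one_add_of_summable
    ((summable_geometric_of_lt_one hq.le hq1).mul_left (-a))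
  refine this.congr fun k => by ring

lemma tendsto_qPochhammerInf (hq : 0 < q) (hq1 : q < 1) (a : ℝ) :
    Tendsto (fun N => ∏ k ∈ Finset.range N, (1 - a * q ^ k)) atTop (𝓝 (qPochhammerInf a q)) :=
  (multipliable_qPochhammer hq hq1 a).tendsto_prod_tprod_nat

lemma qPochhammerInf_self_pos (hq : 0 < q) (hq1 : q < 1) : 0 < qPochhammerInf q q := by
  have h1 : 0 ≤ qPochhammerInf q q :=
    ge_of_tendsto' (tendsto_qPochhammerInf hq hq1 q) fun n => (qFactorial_pos hq hq1 n).le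
  refine h1.lt_of_ne' ?_
  have h2 := tprod_one_add_ne_zero_of_summable (f := fun k : ℕ => -(q * q ^ k)) (fun k => ?_) ?_
  · simpa only [qPochhammerInf, sub_eq_add_neg] using h2
  · rw [← sub_eq_add_neg, ← pow_succ']
    exact (one_sub_pow_pos hq hq1 k).ne'
  · exact ((summable_geometric_of_lt_one hq.le hq1).mul_left q).neg.norm

lemma qPochhammerInf_le_qFactorial (hq : 0 < q) (hq1 : q < 1) (n : ℕ) :
    qPochhammerInf q q ≤ qFactorial q n :=
  (qFactorial_antitone hq hq1).le_of_tendsto (tendsto_qPochhammerInf hq hq1 q) n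

lemma invQFactorial_le (hq : 0 < q) (hq1 : q < 1) (n : ℤ) :
    invQFactorial q n ≤ (qPochhammerInf q q)⁻¹ := by
  unfold invQFactorial
  split_ifs
  · exact inv_anti₀ (qPochhammerInf_self_pos hq hq1) (qPochhammerInf_le_qFactorial hq hq1 _)
  · exact (inv_pos.2 (qPochhammerInf_self_pos hq hq1)).le

lemma tendsto_invQFactorial (hq : 0 < q) (hq1 : q < 1) {u : ℕ → ℤ} (hu : Tendsto u atTop atTop) :
    Tendsto (fun n => invQFactorial q (u n)) atTop (𝓝 (qPochhammerInf q q)⁻¹) := by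
  have h1 : Tendsto (fun n => (u n).toNat) atTop atTop :=
    tendsto_atTop.2 fun b => (hu.eventually_ge_atTop (b : ℤ)).mono fun n hn => by omega
  have h2 := ((tendsto_qPochhammerInf hq hq1 q).comp h1).inv₀ (qPochhammerInf_self_pos hq hq1).ne'
  refine h2.congr' ((hu.eventually_ge_atTop 0).mono fun n hn => ?_)
  simp [invQFactorial, hn, qFactorial]

/-- The Jacobi triple product identity. -/
theorem tsum_thetaTerm (hq : 0 < q) (hq1 : q < 1) (hz : 0 < z) :
    ∑' j, thetaTerm q z j =
      qPochhammerInf (-z) q * qPochhammerInf (-q * z⁻¹) q * qPochhammerInf q q := by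
  set L := qPochhammerInf q q with hL
  have hL0 : 0 < L := qPochhammerInf_self_pos hq hq1
  have h1 : Tendsto (fun N => ∑' j, tripleCoeff q z N j) atTop
      (𝓝 (∑' j, L * L⁻¹ * L⁻¹ * thetaTerm q z j)) := by
    -- The domination uses `(q; q)_{2N} ≤ 1` and `(q; q)_m ≥ (q; q)_∞`.
    refine tendsto_tsum_of_dominated_convergence
      (bound := fun j => 1 * L⁻¹ * L⁻¹ * thetaTerm q z j)
      ((summable_thetaTerm hq hq1 hz).mul_left _) (fun j => ?_)
      (Eventually.of_forall fun N j => ?_)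
    · have t0 : Tendsto (fun N : ℕ => 2 * N) atTop atTop :=
        tendsto_id.const_mul_atTop' two_pos
      have t1 : Tendsto (fun N : ℕ => qFactorial q (2 * N)) atTop (𝓝 L) :=
        (tendsto_qPochhammerInf hq hq1 q).comp t0
      have t2 : Tendsto (fun N : ℕ => (N + j : ℤ)) atTop atTop :=
        tendsto_atTop_add_const_right _ _ tendsto_natCast_atTop_atTop
      have t3 : Tendsto (fun N : ℕ => (N - j : ℤ)) atTop atTop :=
        tendsto_atTop_add_const_right _ _ tendsto_natCast_atTop_atTop
      exact ((t1.mul (tendsto_invQFactorial hq hq1 t2)).mul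
        (tendsto_invQFactorial hq hq1 t3)).mul_const _
    · have p0 := (qFactorial_pos hq hq1 (2 * N)).le
      have p1 := invQFactorial_nonneg hq hq1 (N + j)
      have p2 := invQFactorial_nonneg hq hq1 (N - j)
      have p3 := (thetaTerm_pos hq hz j).le
      have p4 : qFactorial q (2 * N) ≤ 1 := by
        simpa [qFactorial] using qFactorial_antitone hq hq1 (Nat.zero_le (2 * N))
      rw [tripleCoeff, Real.norm_of_nonneg (by positivity)]
      gcongr
      · exact invQFactorial_le hq hq1 _
      · exact invQFactorial_le hq hq1 _
  have h2 := (tendsto_qPochhammerInf hq hq1 (-z)).mul (tendsto_qPochhammerInf hq hq1 (-q * z⁻¹))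
  have h3 := tendsto_nhds_unique h1 (h2.congr fun N => by
    rw [(hasSum_tripleCoeff hq hq1 hz N).tsum_eq]
    congr 1 <;> refine Finset.prod_congr rfl fun k _ => by ring)
  rw [tsum_mul_left, mul_inv_cancel₀ hL0.ne', one_mul] at h3
  rw [← h3]
  field_simp

end DynamicASEP

/-! ### Walks driven by independent coins -/

namespace DynamicASEP

variable {q α : ℝ}

/-- The step of a walk driven by a coin. -/
def coinStep (b : Bool) : ℤ := if b then 1 else -1

/-- The walk that at time `i` and height `k` moves as directed by the coin `c (i, k)`. -/
def walk (c : ℕ × ℤ → Bool) (k : ℤ) : ℕ → ℤ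
  | 0 => k
  | i + 1 => walk c k i + coinStep (c (i, walk c k i))

lemma abs_coinStep (b : Bool) : |coinStep b| = 1 := by cases b <;> simp [coinStep]

/-- The height function made of two walks started at the origin. -/
def twoSidedWalk (w : ℤ × (ℕ × ℤ → Bool) × (ℕ × ℤ → Bool)) : HeightFunction :=
  ⟨fun x => if 0 ≤ x then walk w.2.1 w.1 x.toNat else walk w.2.2 w.1 (-x).toNat, fun x => by
    dsimp only
    rcases lt_trichotomy x (-1) with h | h | h
    · obtain ⟨i, rfl⟩ : ∃ i : ℕ, x = -(i + 1 : ℤ) - 1 := ⟨(-x - 2).toNat, by omega⟩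
      rw [if_neg (by omega), if_neg (by omega), abs_sub_comm,
        show (-(-(i + 1 : ℤ) - 1)).toNat = i + 2 by omega,
        show (-(-(i + 1 : ℤ) - 1 + 1)).toNat = i + 1 by omega, walk, add_sub_cancel_left,
        abs_coinStep]
    · subst h
      simp [walk, abs_coinStep]
    · lift x to ℕ using by omega
      rw [if_pos (by omega), if_pos (by omega), Int.toNat_natCast,
        show ((x : ℤ) + 1).toNat = x + 1 by omega, walk, add_sub_cancel_left, abs_coinStep]⟩

lemma twoSidedWalk_natCast (w : ℤ × (ℕ × ℤ → Bool) × (ℕ × ℤ → Bool)) (i : ℕ) :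
    (twoSidedWalk w).1 i = walk w.2.1 w.1 i := by
  simp [twoSidedWalk]

lemma twoSidedWalk_neg_natCast (w : ℤ × (ℕ × ℤ → Bool) × (ℕ × ℤ → Bool)) (i : ℕ) :
    (twoSidedWalk w).1 (-i) = walk w.2.2 w.1 i := by
  rcases Nat.eq_zero_or_pos i with rfl | h
  · simp [twoSidedWalk, walk]
  · simp [twoSidedWalk, h.ne']

lemma measurable_walk (i : ℕ) :
    Measurable fun p : ℤ × (ℕ × ℤ → Bool) => walk p.2 p.1 i := by
  induction i with
  | zero => exact measurable_fst
  | succ i ih =>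
    have h1 : Measurable fun z : ℤ × (ℕ × ℤ → Bool) => coinStep (z.2 (i, z.1)) :=
      measurable_from_prod_countable_right fun k =>
        (measurable_from_top (f := coinStep)).comp (measurable_pi_apply (i, k))
    exact ih.add (h1.comp (ih.prodMk measurable_snd))

lemma measurable_twoSidedWalk : Measurable twoSidedWalk := by
  refine measurable_of_heights fun y => ?_
  obtain ⟨i, rfl | rfl⟩ := Int.eq_nat_or_neg y
  · simp only [twoSidedWalk_natCast]
    exact (measurable_walk i).comp (measurable_fst.prodMk (measurable_fst.comp measurable_snd))
  · simp only [twoSidedWalk_neg_natCast]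
    exact (measurable_walk i).comp (measurable_fst.prodMk (measurable_snd.comp measurable_snd))

lemma walk_eq_iff (c : ℕ × ℤ → Bool) (g : ℕ → ℤ) (n : ℕ) :
    (∀ i ≤ n, walk c (g 0) i = g i) ↔ ∀ i < n, g i + coinStep (c (i, g i)) = g (i + 1) := by
  constructor
  · intro H i hi
    rw [← H (i + 1) hi, walk, H i hi.le]
  · intro H i
    induction i with
    | zero => intro _; rfl
    | succ i ih =>
      intro hi
      rw [walk, ih (by omega), H i hi]

lemma trans_nonneg (hq : 0 < q) (hα : 0 < α) (k l : ℤ) : 0 ≤ trans q α k l := by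
  unfold trans
  split_ifs <;> positivity

lemma trans_add (hq : 0 < q) (hα : 0 < α) (k : ℤ) :
    trans q α k (k + 1) + trans q α k (k - 1) = 1 := by
  have : 0 < q ^ k := zpow_pos hq k
  rw [trans_up, trans_down]
  field_simp
  ring

/-- The law of the coin at height `k`. -/
noncomputable def coin (q α : ℝ) (k : ℤ) : Measure Bool :=
  ENNReal.ofReal (trans q α k (k + 1)) • Measure.dirac true +
    ENNReal.ofReal (trans q α k (k - 1)) • Measure.dirac false

lemma isProbabilityMeasure_coin (hq : 0 < q) (hα : 0 < α) (k : ℤ) :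
    IsProbabilityMeasure (coin q α k) := by
  refine ⟨?_⟩
  simp only [coin, Measure.add_apply, Measure.smul_apply, measure_univ, smul_eq_mul, mul_one]
  rw [← ENNReal.ofReal_add (trans_nonneg hq hα _ _) (trans_nonneg hq hα _ _), trans_add hq hα,
    ENNReal.ofReal_one]

lemma coin_apply (k l : ℤ) :
    coin q α k {b | k + coinStep b = l} = ENNReal.ofReal (trans q α k l) := by
  simp only [coin, Measure.add_apply, Measure.smul_apply, smul_eq_mul,
    Measure.dirac_apply' _ (MeasurableSet.of_discrete (s := {b : Bool | k + coinStep b = l}))]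
  by_cases h1 : l = k + 1
  · subst h1
    simp [coinStep, Set.indicator]
  · by_cases h2 : l = k - 1
    · subst h2
      have : ¬ k + 1 = k - 1 := by omega
      simp [coinStep, Set.indicator, this, ← sub_eq_add_neg]
    · have h3 : ¬ k + 1 = l := fun h => h1 h.symm
      have h4 : ¬ k - 1 = l := fun h => h2 h.symm
      simp [coinStep, Set.indicator, h3, h4, ← sub_eq_add_neg, trans, h1, h2]

/-- The law of a family of independent coins. -/
noncomputable def coins (q α : ℝ) : Measure (ℕ × ℤ → Bool) :=
  Measure.infinitePi fun p : ℕ × ℤ => coin q α p.2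

/-- Following a prescribed path consults one coin `(i, g i)` at each time. These coins are distinct,
so independence turns the path event into a product. -/
lemma coins_walk (hq : 0 < q) (hα : 0 < α) (g : ℕ → ℤ) (n : ℕ) :
    coins q α {c | ∀ i ≤ n, walk c (g 0) i = g i} =
      ENNReal.ofReal (∏ i ∈ Finset.range n, trans q α (g i) (g (i + 1))) := by
  have := fun p : ℕ × ℤ => isProbabilityMeasure_coin hq hα p.2
  have e : {c : ℕ × ℤ → Bool | ∀ i ≤ n, walk c (g 0) i = g i} =
      Set.pi ((Finset.range n).image fun i => (i, g i) : Finset (ℕ × ℤ))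
        fun p => {b | p.2 + coinStep b = g (p.1 + 1)} := by
    ext c
    rw [Set.mem_ofPred_eq, walk_eq_iff]
    simp [Set.mem_pi]
  rw [e, coins, Measure.infinitePi_pi _ fun _ _ => MeasurableSet.of_discrete,
    Finset.prod_image fun i _ j _ h => (Prod.ext_iff.1 h).1,
    ENNReal.ofReal_prod_of_nonneg fun _ _ => trans_nonneg hq hα _ _]
  exact Finset.prod_congr rfl fun i _ => coin_apply _ _

/-! ### Theta weights and reversibility -/

/-- The normalized terms of the theta series. -/
noncomputable def edgeWeight (q α : ℝ) (k : ℤ) : ℝ :=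
  thetaTerm q α⁻¹ k / ∑' j, thetaTerm q α⁻¹ j

lemma tsum_thetaTerm_pos (hq : 0 < q) (hq1 : q < 1) (hα : 0 < α) :
    0 < ∑' j, thetaTerm q α⁻¹ j :=
  (summable_thetaTerm hq hq1 (inv_pos.2 hα)).tsum_pos
    (fun j => (thetaTerm_pos hq (inv_pos.2 hα) j).le) 0 (thetaTerm_pos hq (inv_pos.2 hα) 0)

lemma edgeWeight_nonneg (hq : 0 < q) (hq1 : q < 1) (hα : 0 < α) (k : ℤ) :
    0 ≤ edgeWeight q α k :=
  div_nonneg (thetaTerm_pos hq (inv_pos.2 hα) k).le (tsum_thetaTerm_pos hq hq1 hα).le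

lemma edgeWeight_add_one (hq : 0 < q) (hα : 0 < α) (k : ℤ) :
    edgeWeight q α (k + 1) = α⁻¹ * q ^ k * edgeWeight q α k := by
  rw [edgeWeight, edgeWeight, thetaTerm_add_one hq (inv_pos.2 hα), mul_div_assoc]

/-- The factor `1 + α⁻¹ q^(2n)` splits the weight into two consecutive theta terms at `z = α⁻¹`, and
the triple product identifies the denominators. -/
lemma weight_eq (hq : 0 < q) (hq1 : q < 1) (hα : 0 < α) (n : ℤ) :
    weight q α n = edgeWeight q α (2 * n) + edgeWeight q α (2 * n + 1) := by
  rw [edgeWeight_add_one hq hα, edgeWeight, tsum_thetaTerm hq hq1 (inv_pos.2 hα), inv_inv, weight,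
    thetaTerm, show 2 * n * (2 * n - 1) / 2 = n * (2 * n - 1) by
      rw [mul_assoc, Int.mul_ediv_cancel_left _ two_ne_zero],
    show α ^ (-2 * n) = α⁻¹ ^ (2 * n) by rw [inv_zpow', neg_mul]]
  ring

lemma hasSum_even_add_odd {f : ℤ → ℝ} {a b : ℝ} (he : HasSum (fun n => f (2 * n)) a)
    (ho : HasSum (fun n => f (2 * n + 1)) b) : HasSum f (a + b) := by
  have h1 : Function.Injective fun n : ℤ => 2 * n := mul_right_injective₀ (two_ne_zero' ℤ)
  have h2 : Function.Injective fun n : ℤ => 2 * n + 1 := (add_left_injective 1).comp h1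
  replace he := (h1.hasSum_range_iff (f := f)).2 he
  replace ho := (h2.hasSum_range_iff (f := f)).2 ho
  refine he.add_isCompl ?_ ho
  simpa using Int.isCompl_even_odd

lemma hasSum_weight (hq : 0 < q) (hq1 : q < 1) (hα : 0 < α) : HasSum (weight q α) 1 := by
  have h1 : HasSum (edgeWeight q α) 1 := by
    have := (summable_thetaTerm hq hq1 (inv_pos.2 hα)).hasSum.div_const
      (∑' j, thetaTerm q α⁻¹ j)
    rwa [div_self (tsum_thetaTerm_pos hq hq1 hα).ne'] at this
  have h2 : HasSum (fun n : ℤ => edgeWeight q α (2 * n)) (∑' n : ℤ, edgeWeight q α (2 * n)) :=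
    (h1.summable.comp_injective fun a b h => by simpa using h).hasSum
  have h3 : HasSum (fun n : ℤ => edgeWeight q α (2 * n + 1))
      (∑' n : ℤ, edgeWeight q α (2 * n + 1)) :=
    (h1.summable.comp_injective fun a b h => by simpa using h).hasSum
  have h4 := hasSum_even_add_odd h2 h3
  have h5 := h2.add h3
  rw [h4.unique h1] at h5
  rwa [funext (weight_eq hq hq1 hα)]

/-- The law of the height at the origin. -/
noncomputable def originLaw (q α : ℝ) : Measure ℤ :=
  Measure.sum fun n : ℤ => ENNReal.ofReal (weight q α n) • Measure.dirac (2 * n)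

/-- The probability that the height at `x` is `k`. -/
noncomputable def siteWeight (q α : ℝ) (x k : ℤ) : ℝ :=
  if 2 ∣ k - x then edgeWeight q α k + edgeWeight q α (k + 1) else 0

lemma siteWeight_nonneg (hq : 0 < q) (hq1 : q < 1) (hα : 0 < α) (x k : ℤ) :
    0 ≤ siteWeight q α x k := by
  unfold siteWeight
  split_ifs
  · exact add_nonneg (edgeWeight_nonneg hq hq1 hα _) (edgeWeight_nonneg hq hq1 hα _)
  · rfl

lemma weight_nonneg (hq : 0 < q) (hq1 : q < 1) (hα : 0 < α) (n : ℤ) : 0 ≤ weight q α n := by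
  rw [weight_eq hq hq1 hα]
  exact add_nonneg (edgeWeight_nonneg hq hq1 hα _) (edgeWeight_nonneg hq hq1 hα _)

lemma isProbabilityMeasure_originLaw (hq : 0 < q) (hq1 : q < 1) (hα : 0 < α) :
    IsProbabilityMeasure (originLaw q α) := by
  refine ⟨?_⟩
  simp only [originLaw, Measure.sum_apply _ MeasurableSet.univ, Measure.smul_apply, measure_univ,
    smul_eq_mul, mul_one]
  have h := hasSum_weight hq hq1 hα
  rw [← ENNReal.ofReal_tsum_of_nonneg (weight_nonneg hq hq1 hα) h.summable, h.tsum_eq,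
    ENNReal.ofReal_one]

lemma originLaw_singleton (hq : 0 < q) (hq1 : q < 1) (hα : 0 < α) (k : ℤ) :
    originLaw q α {k} = ENNReal.ofReal (siteWeight q α 0 k) := by
  simp only [originLaw, Measure.sum_apply _ (measurableSet_singleton k), Measure.smul_apply,
    smul_eq_mul, Measure.dirac_apply' _ (measurableSet_singleton k)]
  rw [siteWeight, sub_zero]
  split_ifs with h
  · obtain ⟨n, rfl⟩ := h
    rw [tsum_eq_single n, weight_eq hq hq1 hα]
    · simp
    · intro m hm
      simp [hm]
  · rw [ENNReal.ofReal_zero]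
    refine ENNReal.tsum_eq_zero.2 fun n => ?_
    have : 2 * n ≠ k := fun hn => h ⟨n, hn.symm⟩
    simp [this]

/-- For neighbouring heights of the right parity both sides equal `edgeWeight` at the larger of `k`
and `l`, the probability of that step; otherwise both vanish. -/
lemma siteWeight_reversible (hq : 0 < q) (hα : 0 < α) (x k l : ℤ) :
    siteWeight q α x k * trans q α k l = siteWeight q α (x + 1) l * trans q α l k := by
  have key : ∀ k : ℤ, (edgeWeight q α k + edgeWeight q α (k + 1)) * trans q α k (k + 1) =
      (edgeWeight q α (k + 1) + edgeWeight q α (k + 1 + 1)) * trans q α (k + 1) k := by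
    intro k
    have h1 := trans_down q α (k + 1)
    rw [add_sub_cancel_right] at h1
    have hk : 0 < q ^ k := zpow_pos hq k
    have hk' : 0 < q ^ (k + 1) := zpow_pos hq _
    rw [h1, trans_up, edgeWeight_add_one hq hα (k + 1), edgeWeight_add_one hq hα k]
    field_simp
  by_cases h1 : l = k + 1
  · subst h1
    rw [siteWeight, siteWeight, add_sub_add_right_eq_sub]
    split_ifs
    · exact key k
    · simp
  · by_cases h2 : l = k - 1
    · obtain ⟨k, rfl⟩ : ∃ j, k = j + 1 := ⟨k - 1, by ring⟩
      rw [add_sub_cancel_right] at h2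
      subst h2
      rw [siteWeight, siteWeight]
      by_cases h : (2 : ℤ) ∣ l + 1 - x
      · rw [if_pos h, if_pos (by omega)]
        exact (key l).symm
      · rw [if_neg h, if_neg (by omega)]
        simp
    · rw [trans, trans, if_neg h1, if_neg h2, if_neg (by omega), if_neg (by omega)]
      simp

/-! ### Construction of the stationary law -/

/-- The candidate for the law of stationary initial data. -/
noncomputable def stationaryLaw (q α : ℝ) : Measure HeightFunction :=
  ((originLaw q α).prod ((coins q α).prod (coins q α))).map twoSidedWalk

lemma isProbabilityMeasure_coins (hq : 0 < q) (hα : 0 < α) : IsProbabilityMeasure (coins q α) := by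
  have := fun p : ℕ × ℤ => isProbabilityMeasure_coin hq hα p.2
  unfold coins
  infer_instance

lemma isProbabilityMeasure_stationaryLaw (hq : 0 < q) (hq1 : q < 1) (hα : 0 < α) :
    IsProbabilityMeasure (stationaryLaw q α) := by
  have := isProbabilityMeasure_originLaw hq hq1 hα
  have := isProbabilityMeasure_coins hq hα
  exact Measure.isProbabilityMeasure_map measurable_twoSidedWalk.aemeasurable

lemma stationaryLaw_cyl_Icc_neg (hq : 0 < q) (hq1 : q < 1) (hα : 0 < α) (m n : ℕ) (h : ℤ → ℤ) :
    (stationaryLaw q α).real (cyl (Finset.Icc (-m : ℤ) n) h) =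
      siteWeight q α 0 (h 0) * (∏ i ∈ Finset.range n, trans q α (h i) (h (i + 1))) *
        ∏ i ∈ Finset.range m, trans q α (h (-i)) (h (-i - 1)) := by
  have := isProbabilityMeasure_originLaw hq hq1 hα
  have := isProbabilityMeasure_coins hq hα
  have e : twoSidedWalk ⁻¹' cyl (Finset.Icc (-m : ℤ) n) h =
      {h 0} ×ˢ ({c | ∀ i ≤ n, walk c (h (0 : ℕ)) i = h i} ×ˢ
        {c | ∀ i ≤ m, walk c (h (-(0 : ℕ))) i = h (-i)}) := by
    ext w
    simp only [Set.mem_preimage, mem_cyl, Finset.mem_Icc, Set.mem_prod, Set.mem_singleton_iff,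
      Set.mem_ofPred_eq, Nat.cast_zero, neg_zero]
    constructor
    · intro H
      have h0 := H 0 ⟨by omega, by omega⟩
      have h0' := twoSidedWalk_natCast w 0
      rw [Nat.cast_zero, h0, walk] at h0'
      refine ⟨h0'.symm, fun i hi => ?_, fun i hi => ?_⟩
      · rw [h0', ← twoSidedWalk_natCast]
        exact H i ⟨by omega, by omega⟩
      · rw [h0', ← twoSidedWalk_neg_natCast]
        exact H (-i) ⟨by omega, by omega⟩
    · rintro ⟨h0, h1, h2⟩ y ⟨hy1, hy2⟩
      obtain ⟨i, rfl | rfl⟩ := Int.eq_nat_or_neg y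
      · rw [twoSidedWalk_natCast, h0]
        exact h1 i (by omega)
      · rw [twoSidedWalk_neg_natCast, h0]
        exact h2 i (by omega)
  have e1 := coins_walk hq hα (fun i => h i) n
  have e2 := coins_walk hq hα (fun i => h (-i)) m
  have p0 := siteWeight_nonneg hq hq1 hα 0 (h 0)
  have p1 : 0 ≤ ∏ i ∈ Finset.range n, trans q α (h i) (h (i + 1 : ℕ)) :=
    Finset.prod_nonneg fun _ _ => trans_nonneg hq hα _ _
  have p2 : 0 ≤ ∏ i ∈ Finset.range m, trans q α (h (-i)) (h (-(i + 1 : ℕ))) :=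
    Finset.prod_nonneg fun _ _ => trans_nonneg hq hα _ _
  rw [measureReal_def, stationaryLaw, Measure.map_apply measurable_twoSidedWalk
    (measurableSet_cyl _ _), e, Measure.prod_prod, Measure.prod_prod, e1, e2,
    originLaw_singleton hq hq1 hα, ENNReal.toReal_mul, ENNReal.toReal_mul,
    ENNReal.toReal_ofReal p0, ENNReal.toReal_ofReal p1, ENNReal.toReal_ofReal p2, mul_assoc]
  push_cast
  simp only [neg_add']

/-- Reversibility, applied step by step, moves the starting point of the chain from `0` to `n` and
turns its direction around. -/
lemma siteWeight_mul_prod (hq : 0 < q) (hα : 0 < α) (n : ℕ) (h : ℤ → ℤ) :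
    siteWeight q α 0 (h 0) * ∏ i ∈ Finset.range n, trans q α (h i) (h (i + 1)) =
      siteWeight q α n (h n) * ∏ i ∈ Finset.range n, trans q α (h (n - i)) (h (n - i - 1)) := by
  induction n with
  | zero => simp
  | succ n ih =>
    rw [Finset.prod_range_succ, ← mul_assoc, ih, Finset.prod_range_succ']
    have := siteWeight_reversible hq hα n (h n) (h (n + 1))
    push_cast
    simp only [sub_zero, add_sub_cancel_right, add_sub_add_right_eq_sub]
    linear_combination (∏ i ∈ Finset.range n, trans q α (h (n - i)) (h (n - i - 1))) * this

lemma cyl_Icc_eq_union {x b : ℤ} (hb : x ≤ b) (h : ℤ → ℤ) :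
    cyl (Finset.Icc x b) h =
      cyl (Finset.Icc (x - 1) b) (Function.update h (x - 1) (h x + 1)) ∪
        cyl (Finset.Icc (x - 1) b) (Function.update h (x - 1) (h x - 1)) := by
  have e : ∀ k, cyl (Finset.Icc x b) (Function.update h (x - 1) k) = cyl (Finset.Icc x b) h :=
    fun k => cyl_congr fun y hy => Function.update_of_ne
      (by rw [Finset.mem_Icc] at hy; omega) _ _
  rw [cyl_Icc_pred hb, cyl_Icc_pred hb, e, e, Function.update_self, Function.update_self,
    ← Set.inter_union_distrib_left]
  ext s
  refine ⟨fun hs => ⟨hs, ?_⟩, fun hs => hs.1⟩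
  rw [← hs x (Finset.mem_Icc.2 ⟨le_rfl, hb⟩)]
  exact (step_cases s x).1

/-- If the window contains the origin, the two walks give its probability and the right half is
reversed. A shorter window follows by summing out the leftmost height, by descending induction on
`j` from `n`. -/
lemma stationaryLaw_cyl (hq : 0 < q) (hq1 : q < 1) (hα : 0 < α) (n j : ℕ) :
    ∀ h : ℤ → ℤ, (stationaryLaw q α).real (cyl (Finset.Icc (n - j : ℤ) n) h) =
      siteWeight q α n (h n) * ∏ i ∈ Finset.range j, trans q α (h (n - i)) (h (n - i - 1)) := by
  have := isProbabilityMeasure_stationaryLaw hq hq1 hα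
  rcases le_total n j with hj | hj
  · intro h
    obtain ⟨m, rfl⟩ := Nat.exists_eq_add_of_le hj
    have := stationaryLaw_cyl_Icc_neg hq hq1 hα m n h
    rw [siteWeight_mul_prod hq hα] at this
    rw [show (n - (n + m : ℕ) : ℤ) = -m by push_cast; ring, this, Finset.prod_range_add, mul_assoc]
    push_cast
    simp only [sub_add_cancel_left]
  · induction hj using Nat.decreasingInduction with
    | self =>
      intro h
      have := stationaryLaw_cyl_Icc_neg hq hq1 hα 0 n h
      rw [siteWeight_mul_prod hq hα] at this
      simpa using this
    | of_succ j hj ih =>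
      intro h
      rw [cyl_Icc_eq_union (by omega), measureReal_union]
      · have ih' := fun k => ih (Function.update h (n - j - 1) k)
        rw [show (n - (j + 1 : ℕ) : ℤ) = n - j - 1 by push_cast; ring] at ih'
        rw [ih', ih', Finset.prod_range_succ, Finset.prod_range_succ]
        have hp : ∀ k, ∏ i ∈ Finset.range j, trans q α (Function.update h (n - j - 1) k (n - i))
            (Function.update h (n - j - 1) k (n - i - 1)) =
            ∏ i ∈ Finset.range j, trans q α (h (n - i)) (h (n - i - 1)) := by
          intro k
          refine Finset.prod_congr rfl fun i hi => ?_
          rw [Finset.mem_range] at hi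
          rw [Function.update_of_ne (by omega), Function.update_of_ne (by omega)]
        rw [hp, hp, Function.update_self, Function.update_self, Function.update_of_ne (by omega),
          Function.update_of_ne (by omega), Function.update_of_ne (by omega),
          Function.update_of_ne (by omega)]
        linear_combination siteWeight q α n (h n) *
          (∏ i ∈ Finset.range j, trans q α (h (n - i)) (h (n - i - 1))) *
          trans_add hq hα (h (n - j))
      · refine Set.disjoint_left.2 fun s hs hs' => ?_
        have h1 := hs (n - j - 1) (Finset.mem_Icc.2 ⟨le_rfl, by omega⟩)
        have h2 := hs' (n - j - 1) (Finset.mem_Icc.2 ⟨le_rfl, by omega⟩)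
        rw [Function.update_self] at h1 h2
        omega
      · exact measurableSet_cyl _ _

lemma stationaryLaw_cyl_pred (hq : 0 < q) (hq1 : q < 1) (hα : 0 < α) {x : ℤ} {n : ℕ}
    (hx : x ≤ n) (h : ℤ → ℤ) :
    (stationaryLaw q α).real (cyl (Finset.Icc (x - 1) n) h) =
      trans q α (h x) (h (x - 1)) * (stationaryLaw q α).real (cyl (Finset.Icc x n) h) := by
  obtain ⟨j, rfl⟩ : ∃ j : ℕ, x = n - j := ⟨(n - x).toNat, by omega⟩
  have h1 := stationaryLaw_cyl hq hq1 hα n (j + 1) h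
  rw [show (n - (j + 1 : ℕ) : ℤ) = n - j - 1 by push_cast; ring] at h1
  rw [h1, stationaryLaw_cyl hq hq1 hα n j h, Finset.prod_range_succ]
  ring

/-- A conditional probability given the heights from `x` on can be checked on cylinders. -/
lemma condExp_eq_of_cyl {μ : Measure HeightFunction} [IsProbabilityMeasure μ] {x : ℤ}
    {E : Set HeightFunction} (hE : MeasurableSet E) {p : ℤ → ℝ} (hp0 : ∀ k, 0 ≤ p k)
    (hp1 : ∀ k, p k ≤ 1)
    (H : ∀ (n : ℕ) (h : ℤ → ℤ), x ≤ n → μ.real (cyl (Finset.Icc x n) h ∩ E) =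
      p (h x) * μ.real (cyl (Finset.Icc x n) h)) :
    μ⟦E | heightsFrom x⟧ =ᵐ[μ] fun s => p (s.1 x) := by
  have hm := heightsFrom_le x
  have hpm : Measurable fun s : HeightFunction => p (s.1 x) := measurable_comp_height p x
  have hint : Integrable (fun s : HeightFunction => p (s.1 x)) μ :=
    Integrable.of_bound (C := 1) hpm.aestronglyMeasurable (ae_of_all _ fun s => by
      rw [Real.norm_of_nonneg (hp0 _)]; exact hp1 _)
  -- The right ends are natural numbers not below `x`, as in the hypothesis `H`.
  have hgen : heightsFrom x = MeasurableSpace.generateFrom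
      (cylinders fun n : ℕ => Finset.Icc x ((x.toNat + n : ℕ) : ℤ)) := by
    rw [generateFrom_cylinders]
    have : (⋃ n : ℕ, ((Finset.Icc x ((x.toNat + n : ℕ) : ℤ) : Finset ℤ) : Set ℤ)) = Set.Ici x := by
      ext y
      simp only [Finset.coe_Icc, Set.mem_iUnion, Set.mem_Icc, Set.mem_Ici]
      exact ⟨fun ⟨n, h, _⟩ => h, fun h => ⟨y.toNat, h, by omega⟩⟩
    rw [this]
  -- The defining property of conditional expectation compares two finite measures on the smaller
  -- σ-algebra, `μ(A ∩ E)` and the integral of `p (s_x)` over `A`. They agree on the generating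
  -- cylinders.
  have key : (μ.restrict E).trim hm =
      (μ.withDensity fun s => ENNReal.ofReal (p (s.1 x))).trim hm := by
    refine ext_of_generateFrom_cylinders hgen ?_ fun n h => ?_
    · intro n m hnm
      exact Finset.Icc_subset_Icc le_rfl (by omega)
    · have hxn : x ≤ (x.toNat + n : ℕ) := by omega
      have hC := measurableSet_cyl_heightsFrom hxn h
      rw [trim_measurableSet_eq hm hC, trim_measurableSet_eq hm hC,
        Measure.restrict_apply (hm _ hC), withDensity_apply _ (hm _ hC),
        lintegral_flow_const (T := cyl (Finset.Icc x ((x.toNat + n : ℕ) : ℤ)) h) (c := p (h x))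
          (hm _ hC) (hm _ hC) subset_rfl (fun s hs hs' => absurd hs hs')
          fun s hs => by rw [hs x (Finset.mem_Icc.2 ⟨le_rfl, hxn⟩)], mul_comm, ← H _ _ hxn,
        ofReal_measureReal]
  refine (ae_eq_condExp_of_forall_setIntegral_eq hm ((integrable_const _).indicator hE)
    (fun _ _ _ => hint.integrableOn) (fun A hA _ => ?_) ?_).symm
  · have h1 := congrArg (fun ν => ν A) key
    rw [trim_measurableSet_eq hm hA, trim_measurableSet_eq hm hA,
      Measure.restrict_apply (hm _ hA), withDensity_apply _ (hm _ hA)] at h1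
    rw [setIntegral_indicator hE, setIntegral_const, smul_eq_mul, mul_one,
      integral_eq_lintegral_of_nonneg_ae (ae_of_all _ fun s => hp0 _) hpm.aestronglyMeasurable,
      ← h1, measureReal_def]
  · have : Measurable[heightsFrom x] fun s : HeightFunction => s.1 x :=
      Measurable.of_comap_le (le_iSup₂ (f := fun (y : ℤ) (_ : y ∈ Set.Ici x) =>
        MeasurableSpace.comap (fun s : HeightFunction => s.1 y) inferInstance) x
        (Set.mem_Ici.2 le_rfl))
    exact ((measurable_from_top (f := p)).comp this).stronglyMeasurable.aestronglyMeasurable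

theorem isStationaryInitialData_stationaryLaw (hq : 0 < q) (hq1 : q < 1) (hα : 0 < α) :
    IsStationaryInitialData q α (stationaryLaw q α) := by
  have hP := isProbabilityMeasure_stationaryLaw hq hq1 hα
  have key : ∀ (x c : ℤ) (n : ℕ) (h : ℤ → ℤ), x ≤ n → (stationaryLaw q α).real
      (cyl (Finset.Icc x n) h ∩ {s : HeightFunction | s.1 (x - 1) = s.1 x + c}) =
      trans q α (h x) (h x + c) * (stationaryLaw q α).real (cyl (Finset.Icc x n) h) := by
    intro x c n h hx
    have h1 := stationaryLaw_cyl_pred hq hq1 hα hx (Function.update h (x - 1) (h x + c))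
    have e : cyl (Finset.Icc x n) (Function.update h (x - 1) (h x + c)) =
        cyl (Finset.Icc x n) h := cyl_congr fun y hy => Function.update_of_ne
      (by rw [Finset.mem_Icc] at hy; omega) _ _
    rw [cyl_Icc_pred hx, e, Function.update_self, Function.update_of_ne (by omega)] at h1
    rw [← h1]
    congr 1
    ext s
    refine and_congr_right fun hs => ?_
    simp [hs x (Finset.mem_Icc.2 ⟨le_rfl, hx⟩)]
  have le_one : ∀ k, trans q α k (k + 1) ≤ 1 ∧ trans q α k (k - 1) ≤ 1 := fun k => by
    have := trans_add hq hα k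
    have := trans_nonneg hq hα k (k + 1)
    have := trans_nonneg hq hα k (k - 1)
    constructor <;> linarith
  refine ⟨hP, fun x => ?_, fun x => ?_, ?_⟩
  · have := condExp_eq_of_cyl (μ := stationaryLaw q α) (x := x)
      (E := {s : HeightFunction | s.1 (x - 1) = s.1 x + 1})
      (measurableSet_eq_fun (measurable_height _) ((measurable_height _).add_const 1))
      (p := fun k => trans q α k (k + 1)) (fun k => trans_nonneg hq hα _ _) (fun k => (le_one k).1)
      fun n h hx => key x 1 n h hx
    simpa only [trans_up] using this
  · have := condExp_eq_of_cyl (μ := stationaryLaw q α) (x := x)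
      (E := {s : HeightFunction | s.1 (x - 1) = s.1 x - 1})
      (measurableSet_eq_fun (measurable_height _) ((measurable_height _).sub_const 1))
      (p := fun k => trans q α k (k - 1)) (fun k => trans_nonneg hq hα _ _) (fun k => (le_one k).2)
      fun n h hx => key x (-1) n h hx
    simpa only [trans_down] using this
  · have := isProbabilityMeasure_originLaw hq hq1 hα
    have := isProbabilityMeasure_coins hq hα
    rw [stationaryLaw, Measure.map_map (measurable_height 0) measurable_twoSidedWalk]
    have : (fun s : HeightFunction => s.1 0) ∘ twoSidedWalk = Prod.fst := by
      funext w
      simpa [walk] using twoSidedWalk_natCast w 0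
    rw [this, Measure.map_fst_prod, measure_univ, one_smul]
    rfl

end DynamicASEP

/-- Stationary initial data exists, and it is invariant under the dynamic ASEP evolution. -/
theorem theorem2p4 (q α : ℝ) (hq0 : 0 < q) (hq1 : q < 1) (hα : 0 < α) :
    (∃ μ : Measure DynamicASEP.HeightFunction, DynamicASEP.IsStationaryInitialData q α μ) ∧
    ∀ μ : Measure DynamicASEP.HeightFunction, DynamicASEP.IsStationaryInitialData q α μ →
      ∀ {Ω : Type*} {mΩ : MeasurableSpace Ω} (P : Measure Ω) [IsProbabilityMeasure P]
        (ℱ : Filtration ℝ≥0 mΩ) (X : ℝ≥0 → Ω → DynamicASEP.HeightFunction),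
        DynamicASEP.IsDynamicASEP q α P ℱ X → P.map (X 0) = μ → ∀ t : ℝ≥0, P.map (X t) = μ := by
  refine ⟨⟨_, DynamicASEP.isStationaryInitialData_stationaryLaw hq0 hq1 hα⟩, ?_⟩
  intro μ hμ Ω mΩ P _ ℱ X hX h0 t
  exact hX.map_eq hq0 hq1 hα hμ h0 t
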